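/- **Logic.** Types are $\iota$ (individuals), $o$ (truth values), $\epsilon$ (constructions) and $\alpha\to\beta$. Expressions are built from variables $x_\alpha$ and typed constants by application $F\,A$, abstraction $\lambda x_\alpha.B$, quotation $\ulcorner A\urcorner$ (of type $\epsilon$, where $A$ contains no evaluation) and evaluation $[\![A_\epsilon]\!]_\beta$ (of type $\beta$). The logical constants are equality at each type, $\mathsf{is\text{-}var}$, $\mathsf{is\text{-}con}$, $\mathsf{is\text{-}expr}$ (each also in a version for every type), $\mathsf{app}$, $\mathsf{abs}$, $\mathsf{quo}$, the proper-subexpression relation $\sqsubset$ and $\mathsf{is\text{-}free\text{-}in}$; $T,F,\wedge,\supset,\neg,\vee,\forall,\exists$ are defined from equality as in Andrews' $\mathcal Q_0$. A theory is a set of constants containing the logical ones together with a set of formulas over these constants. $T\vdash A$ means that $A$ is derivable, by the rule allowing to replace in a formula one occurrence of $A$ (not in a quotation, not the bound variable of an abstraction, not in the type-fixing part of an evaluation) by $B$ when $A=B$ has been derived, from the axioms of $T$ and the logical axioms of CTT$_{\rm qe}$ in the language of $T$: those of $\mathcal Q_0$ without description (truth values, Leibniz' law, extensionality, beta-reduction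 one step at a time), the axioms specifying $\mathsf{is\text{-}var}$, $\mathsf{is\text{-}con}$, $\mathsf{is\text{-}expr}$ and $\mathsf{is\text{-}free\text{-}in}$, distinctness and injectivity of constructions, $\sqsubset$ with induction on constructions, the laws of quotation ($\ulcorner F A\urcorner=\mathsf{app}\,\ulcorner F\urcorner\,\ulcorner A\urcorner$, $\ulcorner\lambda x.B\urcorner=\mathsf{abs}\,\ulcorner x\urcorner\,\ulcorner B\urcorner$, $\ulcorner\ulcorner A\urcorner\urcorner=\mathsf{quo}\,\ulcorner A\urcorner$) and the laws of evaluation, and the axioms on effectiveness. Here "$x$ is effective in $B$" abbreviates $\mathrm{Eff}(x,B):=\exists y.\,(\lambda x.B)\,y\neq B$ with $y\ne x$ of the same type. The axioms on effectiveness are $\neg\mathrm{Eff}(x,B)$ for $B$ free of evaluations and $x$ not free in $B$, and, for distinct variables $x,y$, the axiom $$\text{(P)}\quad \bigl(\neg\mathrm{Eff}(y,A)\vee\neg\mathrm{Eff}(x,B)\bigr)\supset(\lambda x.\lambda y.B)\,A=\lambda y.\bigl((\lambda x.B)\,A\bigr).$$ Let CTT$_{\rm qe}'$ be the weaker system that has,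 in place of (P), $$\text{(U)}\quad \bigl((\forall y.\,\neg\mathrm{Eff}(y,A))\vee(\forall y.\forall x.\,\neg\mathrm{Eff}(x,B))\bigr)\supset(\lambda x.\lambda y.B)\,A=\lambda y.\bigl((\lambda x.B)\,A\bigr).$$ **The theory $T_R$.** Its nonlogical constants are $0,1,-,+,*,{}^{-1},\mathsf{pos},<,\le,\mathsf{ub},\mathsf{lub}$ on $\iota$; $-,+,*$ on functions $\iota\to\iota$; $\mathsf{is\text{-}diff}$, $\mathsf{deriv}$, $\mathsf{is\text{-}poly}$, $\mathsf{poly\text{-}diff}$. Its axioms are: 1. $\iota$ is a complete ordered field: the field axioms (with $x\neq0\supset x*x^{-1}=1$), the axioms of an order with positive elements $\mathsf{pos}$, $x<y\equiv\mathsf{pos}(y+(-x))$, $x\le y\equiv(x<y\vee x=y)$, the definitions of upper bound and least upper bound of a set $p_{\iota\to o}$, and: every nonempty $p$ with an upper bound has a least upper bound. 2. The operations on functions are pointwise. 3. $\mathsf{is\text{-}diff}\,f\equiv\forall x\,\exists y.\,D(f,x,y)$ and $\mathsf{is\text{-}diff}\,f\supset\forall x.\,D(f,x,\mathsf{deriv}\,f\,x)$,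 where $D(f,a,d)$ is the formula $\forall u>0\,\exists v>0\,\forall w.\,(w\ne0\wedge -v<w<v)\supset -u<(f(a+w)-f(a))*w^{-1}-d<u$. 4. $\mathsf{is\text{-}poly}\,u$ holds iff $u$ is $\ulcorner x_\iota\urcorner$, $\ulcorner y_\iota\urcorner$, $\ulcorner 0\urcorner$, $\ulcorner1\urcorner$, or one of $\ulcorner -v\urcorner,\ulcorner v+w\urcorner,\ulcorner v*w\urcorner$ (with $v,w$ inserted) for $v,w$ satisfying $\mathsf{is\text{-}poly}$. 5. $\mathsf{poly\text{-}diff}\,a\,z$ obeys, for $z$ a variable of type $\iota$, the usual rules: $\ulcorner1\urcorner$ if $a=z$; $\ulcorner0\urcorner$ if $a$ is another variable or a constant of type $\iota$; $\ulcorner-a'\urcorner$, $\ulcorner a'+b'\urcorner$ and $\ulcorner a'*b+a*b'\urcorner$ for the negation, sum and product of polynomials $a,b$ with $a'=\mathsf{poly\text{-}diff}\,a\,z$, $b'=\mathsf{poly\text{-}diff}\,b\,z$. Put $2:=1+1$, $A^0:=1$ and $A^{m+1}:=A^m*A$. **Proposition.** Let $T$ be a theory whose constants and axioms include those of $T_R$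 (for instance $T=T_R$). Then $$T\;\vdash\;\mathsf{deriv}\,(\lambda x_\iota.\,x_\iota^2)\;=\;\lambda x_\iota.\,2*x_\iota ,$$ in CTT$_{\rm qe}$ and also in CTT$_{\rm qe}'$. -/

import Mathlib

namespace CTTqe

/-! ## Types, constants and expressions -/

/-- Types: individuals, truth values, constructions, function types. -/
inductive Ty : Type
  | iota : Ty
  | omicron : Ty
  | eps : Ty
  | fn : Ty → Ty → Ty

infixr:60 " ⇒ " => CTTqe.Ty.fn

open Ty

/-- Constants. `Const α` is the set of constants (typed symbols) of type `α`. The first group are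
the logical constants; the second group are the nonlogical constants used to speak about the real
numbers, differentiation and polynomials; `other α n` is an unlimited supply of further nonlogical
constants of every type. -/
inductive Const : Ty → Type
  -- logical constants
  | eq (α : Ty) : Const (α ⇒ α ⇒ omicron)
  | isVar : Const (eps ⇒ omicron)
  | isVarOf (α : Ty) : Const (eps ⇒ omicron)
  | isCon : Const (eps ⇒ omicron)
  | isConOf (α : Ty) : Const (eps ⇒ omicron)
  | app : Const (eps ⇒ eps ⇒ eps)
  | abs : Const (eps ⇒ eps ⇒ eps)
  | quo : Const (eps ⇒ eps)
  | isExpr : Const (eps ⇒ omicron)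
  | isExprOf (α : Ty) : Const (eps ⇒ omicron)
  | sub : Const (eps ⇒ eps ⇒ omicron)
  | isFreeIn : Const (eps ⇒ eps ⇒ omicron)
  -- field operations and order
  | zero : Const iota
  | one : Const iota
  | neg : Const (iota ⇒ iota)
  | add : Const (iota ⇒ iota ⇒ iota)
  | mul : Const (iota ⇒ iota ⇒ iota)
  | inv : Const (iota ⇒ iota)
  | pos : Const (iota ⇒ omicron)
  | lt : Const (iota ⇒ iota ⇒ omicron)
  | le : Const (iota ⇒ iota ⇒ omicron)
  | ub : Const (iota ⇒ (iota ⇒ omicron) ⇒ omicron)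
  | lub : Const (iota ⇒ (iota ⇒ omicron) ⇒ omicron)
  -- operations on functions
  | fneg : Const ((iota ⇒ iota) ⇒ (iota ⇒ iota))
  | fadd : Const ((iota ⇒ iota) ⇒ (iota ⇒ iota) ⇒ (iota ⇒ iota))
  | fmul : Const ((iota ⇒ iota) ⇒ (iota ⇒ iota) ⇒ (iota ⇒ iota))
  -- differentiation
  | isDiff : Const ((iota ⇒ iota) ⇒ omicron)
  | deriv : Const ((iota ⇒ iota) ⇒ (iota ⇒ iota))
  | isPoly : Const (eps ⇒ omicron)
  | polyDiff : Const (eps ⇒ eps ⇒ eps)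
  -- further constants
  | other (α : Ty) (n : ℕ) : Const α

/-- Constants of all types together. -/
abbrev Sym : Type := Σ α : Ty, Const α

/-- Eval-free expressions of type `α`. The variables of type `α` are `var α 0, var α 1, …`. -/
inductive EFExpr : Ty → Type
  | var (α : Ty) (n : ℕ) : EFExpr α
  | con {α : Ty} (c : Const α) : EFExpr α
  | app {α β : Ty} (F : EFExpr (α ⇒ β)) (A : EFExpr α) : EFExpr β
  | lam {β : Ty} (α : Ty) (n : ℕ) (B : EFExpr β) : EFExpr (α ⇒ β)
  | quo {α : Ty} (A : EFExpr α) : EFExpr eps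

/-- Expressions of type `α`. Only eval-free expressions can be quoted; the second argument of an
evaluation `eval A B` only serves to fix the type of the evaluation. -/
inductive Expr : Ty → Type
  | var (α : Ty) (n : ℕ) : Expr α
  | con {α : Ty} (c : Const α) : Expr α
  | app {α β : Ty} (F : Expr (α ⇒ β)) (A : Expr α) : Expr β
  | lam {β : Ty} (α : Ty) (n : ℕ) (B : Expr β) : Expr (α ⇒ β)
  | quo {α : Ty} (A : EFExpr α) : Expr eps
  | eval {β : Ty} (A : Expr eps) (B : Expr β) : Expr β

/-- Formulas are expressions of type `omicron`. -/
abbrev Formula : Type := Expr omicron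

/-- An eval-free expression, regarded as an expression. -/
def EFExpr.toExpr : {α : Ty} → EFExpr α → Expr α
  | _, .var α n => .var α n
  | _, .con c => .con c
  | _, .app F A => .app F.toExpr A.toExpr
  | _, .lam α n B => .lam α n B.toExpr
  | _, .quo A => .quo A

/-- `FreeIn α n B`: the variable `var α n` is free in the eval-free expression `B`
(variable occurrences inside quotations do not count). -/
def FreeIn (α : Ty) (n : ℕ) : {β : Ty} → EFExpr β → Prop
  | _, .var β m => α = β ∧ n = m
  | _, .con _ => False
  | _, .app F A => FreeIn α n F ∨ FreeIn α n A
  | _, .lam β m B => ¬(α = β ∧ n = m) ∧ FreeIn α n B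
  | _, .quo _ => False

/-- All constants occurring in `A`, also inside quotations, belong to `D`. -/
def EFExpr.InLang (D : Set Sym) : {α : Ty} → EFExpr α → Prop
  | _, .var _ _ => True
  | α, .con c => (⟨α, c⟩ : Sym) ∈ D
  | _, .app F A => F.InLang D ∧ A.InLang D
  | _, .lam _ _ B => B.InLang D
  | _, .quo A => A.InLang D

/-- `A` is a `D`-expression: all constants occurring in `A` belong to `D`. -/
def Expr.InLang (D : Set Sym) : {α : Ty} → Expr α → Prop
  | _, .var _ _ => True
  | α, .con c => (⟨α, c⟩ : Sym) ∈ D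
  | _, .app F A => F.InLang D ∧ A.InLang D
  | _, .lam _ _ B => B.InLang D
  | _, .quo A => A.InLang D
  | _, .eval A B => A.InLang D ∧ B.InLang D

/-- `ReplaceOne A B C C'`: `C'` results from `C` by replacing one occurrence of `A` by `B`, where
the occurrence is not within a quotation, not the bound variable of a function abstraction, and not
in the second argument of an evaluation. -/
inductive ReplaceOne {α : Ty} (A B : Expr α) : {β : Ty} → Expr β → Expr β → Prop
  | here : ReplaceOne A B A B
  | appLeft {β γ : Ty} {F F' : Expr (β ⇒ γ)} (X : Expr β) :
      ReplaceOne A B F F' → ReplaceOne A B (.app F X) (.app F' X)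
  | appRight {β γ : Ty} (F : Expr (β ⇒ γ)) {X X' : Expr β} :
      ReplaceOne A B X X' → ReplaceOne A B (.app F X) (.app F X')
  | lam {γ : Ty} (β : Ty) (n : ℕ) {X X' : Expr γ} :
      ReplaceOne A B X X' → ReplaceOne A B (.lam β n X) (.lam β n X')
  | eval {β : Ty} {X X' : Expr eps} (Y : Expr β) :
      ReplaceOne A B X X' → ReplaceOne A B (.eval X Y) (.eval X' Y)

/-! ## Defined logical constants and abbreviations -/

infixl:100 " ⬝ " => CTTqe.Expr.app

/-- The actual variables `f, g, h, u, v, w, x, y, z, p` of each type. -/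
abbrev nf : ℕ := 0
abbrev ng : ℕ := 1
abbrev nh : ℕ := 2
abbrev nu : ℕ := 3
abbrev nv : ℕ := 4
abbrev nw : ℕ := 5
abbrev nx : ℕ := 6
abbrev ny : ℕ := 7
abbrev nz : ℕ := 8
abbrev np : ℕ := 9

/-- `A = B`. -/
def eqn {α : Ty} (A B : Expr α) : Formula := .con (.eq α) ⬝ A ⬝ B

infix:50 " ≐ " => CTTqe.eqn

/-- Truth. -/
def tt : Formula :=
  (Expr.con (.eq omicron) : Expr (omicron ⇒ omicron ⇒ omicron)) ≐ .con (.eq omicron)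

/-- Falsehood. -/
def ff : Formula := Expr.lam omicron nx tt ≐ .lam omicron nx (.var omicron nx)

/-- `∀ x_α. A`, where `x_α` is `var α n`. -/
def all (α : Ty) (n : ℕ) (A : Formula) : Formula := Expr.lam α n tt ≐ .lam α n A

/-- The connective `∧` of type `o → o → o`. -/
def andC : Expr (omicron ⇒ omicron ⇒ omicron) :=
  .lam omicron nx (.lam omicron ny
    (Expr.lam (omicron ⇒ omicron ⇒ omicron) ng (.var (omicron ⇒ omicron ⇒ omicron) ng ⬝ tt ⬝ tt) ≐
      .lam (omicron ⇒ omicron ⇒ omicron) ng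
        (.var (omicron ⇒ omicron ⇒ omicron) ng ⬝ .var omicron nx ⬝ .var omicron ny)))

/-- `A ∧ B`. -/
def conj (A B : Formula) : Formula := andC ⬝ A ⬝ B

infixr:35 " ⋏ " => CTTqe.conj

/-- The connective `⊃` of type `o → o → o`. -/
def impC : Expr (omicron ⇒ omicron ⇒ omicron) :=
  .lam omicron nx (.lam omicron ny
    (.var omicron nx ≐ (.var omicron nx ⋏ .var omicron ny)))

/-- `A ⊃ B`. -/
def imp (A B : Formula) : Formula := impC ⬝ A ⬝ B

infixr:25 " ⊃ₒ " => CTTqe.imp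

/-- The connective `¬` of type `o → o`. -/
def notC : Expr (omicron ⇒ omicron) := .con (.eq omicron) ⬝ ff

/-- `¬ A`. -/
def neg (A : Formula) : Formula := notC ⬝ A

/-- The connective `∨` of type `o → o → o`. -/
def orC : Expr (omicron ⇒ omicron ⇒ omicron) :=
  .lam omicron nx (.lam omicron ny
    (neg (neg (.var omicron nx) ⋏ neg (.var omicron ny))))

/-- `A ∨ B`. -/
def disj (A B : Formula) : Formula := orC ⬝ A ⬝ B

infixr:30 " ⋎ " => CTTqe.disj

/-- `∃ x_α. A`, where `x_α` is `var α n`. -/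
def ex (α : Ty) (n : ℕ) (A : Formula) : Formula := neg (all α n (neg A))

/-- `A ≠ B`. -/
def neqn {α : Ty} (A B : Expr α) : Formula := neg (A ≐ B)

infix:50 " ≐̸ " => CTTqe.neqn

/-- "`x_α` is effective in `B`", i.e. `∃ y_α. (λ x_α. B) y_α ≠ B`, where `x_α` is `var α n` and
`y_α` is `var α m`; it is used with `m ≠ n`. -/
def isEffectiveIn {β : Ty} (α : Ty) (n m : ℕ) (B : Expr β) : Formula :=
  ex α m (Expr.lam α n B ⬝ .var α m ≐̸ B)

/-! Applications of the logical constants that speak about constructions. -/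

/-- The quotation of a variable. -/
def qvar (α : Ty) (n : ℕ) : Expr eps := .quo (.var α n)
/-- The quotation of a constant. -/
def qcon {α : Ty} (c : Const α) : Expr eps := .quo (.con c)
def isVar (A : Expr eps) : Formula := .con .isVar ⬝ A
def isVarOf (α : Ty) (A : Expr eps) : Formula := .con (.isVarOf α) ⬝ A
def isCon (A : Expr eps) : Formula := .con .isCon ⬝ A
def isConOf (α : Ty) (A : Expr eps) : Formula := .con (.isConOf α) ⬝ A
def isExpr (A : Expr eps) : Formula := .con .isExpr ⬝ A
def isExprOf (α : Ty) (A : Expr eps) : Formula := .con (.isExprOf α) ⬝ A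
def appE (A B : Expr eps) : Expr eps := .con .app ⬝ A ⬝ B
def absE (A B : Expr eps) : Expr eps := .con .abs ⬝ A ⬝ B
def quoE (A : Expr eps) : Expr eps := .con .quo ⬝ A
def subE (A B : Expr eps) : Formula := .con .sub ⬝ A ⬝ B
def isFreeIn (A B : Expr eps) : Formula := .con .isFreeIn ⬝ A ⬝ B

/-- Constructions: the syntactic values that represent syntax trees. -/
inductive IsConstruction : Expr eps → Prop
  | var (α : Ty) (n : ℕ) : IsConstruction (qvar α n)
  | con {α : Ty} (c : Const α) : IsConstruction (qcon c)
  | app {A B : Expr eps} : IsConstruction A → IsConstruction B → IsConstruction (appE A B)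
  | abs {A B : Expr eps} : IsConstruction A → IsConstruction B → IsConstruction (absE A B)
  | quo {A : Expr eps} : IsConstruction A → IsConstruction (quoE A)

/-! The variables `u, v, w, x, y, z` of type `eps`. -/

abbrev uE : Expr eps := .var eps nu
abbrev vE : Expr eps := .var eps nv
abbrev wE : Expr eps := .var eps nw
abbrev xE : Expr eps := .var eps nx
abbrev yE : Expr eps := .var eps ny
abbrev zE : Expr eps := .var eps nz

/-! ## The proof system -/

/-- The axiom on beta-reduction under a binder has a premise saying that a variable is not effective
in an expression. `pointwise`: the premise is asserted of the current values of the variables.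
`uniform`: the premise is asserted of all values of the two bound variables that the axiom is about.
The `uniform` axiom has the stronger premise, so it is a consequence of the `pointwise` one. -/
inductive EffectForm : Type
  | pointwise : EffectForm
  | uniform : EffectForm

/-- The axioms. Variables are given by their type and number, so that e.g. `var α n` and `var β m`
are distinct iff `¬(α = β ∧ n = m)`. -/
inductive Axiom (k : EffectForm) : Formula → Prop
  -- truth values, Leibniz' law, extensionality
  | truthValues : Axiom k
      ((.var (omicron ⇒ omicron) ng ⬝ tt ⋏ .var (omicron ⇒ omicron) ng ⬝ ff) ≐
        all omicron nx (.var (omicron ⇒ omicron) ng ⬝ .var omicron nx))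
  | leibniz (α : Ty) : Axiom k
      (Expr.var α nx ≐ .var α ny ⊃ₒ
        .var (α ⇒ omicron) nh ⬝ .var α nx ≐ .var (α ⇒ omicron) nh ⬝ .var α ny)
  | extensionality (α β : Ty) : Axiom k
      ((Expr.var (α ⇒ β) nf ≐ .var (α ⇒ β) ng) ≐
        all α nx (.var (α ⇒ β) nf ⬝ .var α nx ≐ .var (α ⇒ β) ng ⬝ .var α nx))
  -- beta-reduction
  | betaVarNe {α β : Ty} {n m : ℕ} (A : Expr α) (h : ¬(α = β ∧ n = m)) : Axiom k
      (Expr.lam α n (.var β m) ⬝ A ≐ .var β m)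
  | betaVar {α : Ty} (n : ℕ) (A : Expr α) : Axiom k
      (Expr.lam α n (.var α n) ⬝ A ≐ A)
  | betaCon {α β : Ty} (n : ℕ) (c : Const β) (A : Expr α) : Axiom k
      (Expr.lam α n (.con c) ⬝ A ≐ .con c)
  | betaApp {α β γ : Ty} (n : ℕ) (B : Expr (β ⇒ γ)) (C : Expr β) (A : Expr α) : Axiom k
      (Expr.lam α n (B ⬝ C) ⬝ A ≐ (Expr.lam α n B ⬝ A) ⬝ (Expr.lam α n C ⬝ A))
  | betaLamArg {α β γ : Ty} {n m : ℕ} (B : Expr γ) (A : EFExpr α)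
      (h : ¬(α = β ∧ n = m)) (hfree : ¬FreeIn β m A) : Axiom k
      (Expr.lam α n (.lam β m B) ⬝ A.toExpr ≐ .lam β m (Expr.lam α n B ⬝ A.toExpr))
  | betaLamBody {α β γ : Ty} {n m : ℕ} (B : EFExpr γ) (A : Expr α)
      (h : ¬(α = β ∧ n = m)) (hfree : ¬FreeIn α n B) : Axiom k
      (Expr.lam α n (.lam β m B.toExpr) ⬝ A ≐ .lam β m (Expr.lam α n B.toExpr ⬝ A))
  | betaLamSame {α β : Ty} (n : ℕ) (B : Expr β) (A : Expr α) : Axiom k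
      (Expr.lam α n (.lam α n B) ⬝ A ≐ .lam α n B)
  -- is-var
  | isVarOfIsVar (α : Ty) : Axiom k (isVarOf α xE ⊃ₒ isVar xE)
  | isVarOfVar (α : Ty) (n : ℕ) : Axiom k (isVarOf α (qvar α n))
  | isVarOfVarNe {α β : Ty} (n : ℕ) (h : α ≠ β) : Axiom k (neg (isVarOf α (qvar β n)))
  | isVarNot {A : Expr eps} (hA : IsConstruction A) (h : ∀ α n, A ≠ qvar α n) :
      Axiom k (neg (isVar A))
  -- is-con
  | isConOfIsCon (α : Ty) : Axiom k (isConOf α xE ⊃ₒ isCon xE)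
  | isConOfCon {α : Ty} (c : Const α) : Axiom k (isConOf α (qcon c))
  | isConOfConNe {α β : Ty} (c : Const β) (h : α ≠ β) : Axiom k (neg (isConOf α (qcon c)))
  | isConNot {A : Expr eps} (hA : IsConstruction A) (h : ∀ (α : Ty) (c : Const α), A ≠ qcon c) :
      Axiom k (neg (isCon A))
  -- is-expr
  | isExprOfIsExpr (α : Ty) : Axiom k (isExprOf α xE ⊃ₒ isExpr xE)
  | isExprOfBase (α : Ty) : Axiom k (isVarOf α xE ⋎ isConOf α xE ⊃ₒ isExprOf α xE)
  | isExprOfApp (α β : Ty) : Axiom k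
      (isExprOf (α ⇒ β) xE ⋏ isExprOf α yE ⊃ₒ isExprOf β (appE xE yE))
  | isExprOfAbs (α β : Ty) : Axiom k
      (isVarOf α xE ⋏ isExprOf β yE ⊃ₒ isExprOf (α ⇒ β) (absE xE yE))
  | isExprOfQuo : Axiom k (isExpr xE ⊃ₒ isExprOf eps (quoE xE))
  | isExprAppMismatch {α β : Ty} (h : ∀ γ : Ty, α ≠ (β ⇒ γ)) : Axiom k
      (isExprOf α xE ⋏ isExprOf β yE ⊃ₒ neg (isExpr (appE xE yE)))
  | isExprAppNot : Axiom k
      (neg (isExpr xE) ⋎ neg (isExpr yE) ⊃ₒ neg (isExpr (appE xE yE)))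
  | isExprAbsNot : Axiom k
      (neg (isVar xE) ⋎ neg (isExpr yE) ⊃ₒ neg (isExpr (absE xE yE)))
  | isExprQuoNot : Axiom k (neg (isExpr xE) ⊃ₒ neg (isExpr (quoE xE)))
  -- constructions are distinct
  | distinctVar : Axiom k
      (isVar xE ⊃ₒ neg (isCon xE) ⋏ xE ≐̸ appE yE zE ⋏ xE ≐̸ absE yE zE ⋏ xE ≐̸ quoE yE)
  | distinctCon : Axiom k
      (isCon xE ⊃ₒ neg (isVar xE) ⋏ xE ≐̸ appE yE zE ⋏ xE ≐̸ absE yE zE ⋏ xE ≐̸ quoE yE)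
  | distinctApp : Axiom k
      (xE ≐ appE yE zE ⊃ₒ
        neg (isVar xE) ⋏ neg (isCon xE) ⋏ xE ≐̸ absE uE vE ⋏ xE ≐̸ quoE uE)
  | distinctAbs : Axiom k
      (xE ≐ absE yE zE ⊃ₒ
        neg (isVar xE) ⋏ neg (isCon xE) ⋏ xE ≐̸ appE uE vE ⋏ xE ≐̸ quoE uE)
  | distinctQuo : Axiom k
      (xE ≐ quoE yE ⊃ₒ
        neg (isVar xE) ⋏ neg (isCon xE) ⋏ xE ≐̸ appE uE vE ⋏ xE ≐̸ absE uE vE)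
  | varNe {α β : Ty} {n m : ℕ} (h : ¬(α = β ∧ n = m)) : Axiom k (qvar α n ≐̸ qvar β m)
  | conNe {α β : Ty} {c : Const α} {d : Const β} (h : (⟨α, c⟩ : Sym) ≠ ⟨β, d⟩) :
      Axiom k (qcon c ≐̸ qcon d)
  | appInj : Axiom k (appE xE yE ≐ appE uE vE ⊃ₒ xE ≐ uE ⋏ yE ≐ vE)
  | absInj : Axiom k (absE xE yE ≐ absE uE vE ⊃ₒ xE ≐ uE ⋏ yE ≐ vE)
  | quoInj : Axiom k (quoE xE ≐ quoE uE ⊃ₒ xE ≐ uE)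
  -- the subexpression relation and induction
  | subAppLeft : Axiom k (subE xE (appE xE yE))
  | subAppRight : Axiom k (subE xE (appE yE xE))
  | subAbsLeft : Axiom k (subE xE (absE xE yE))
  | subAbsRight : Axiom k (subE xE (absE yE xE))
  | subQuo : Axiom k (subE xE (quoE xE))
  | subTrans : Axiom k (subE xE yE ⋏ subE yE zE ⊃ₒ subE xE zE)
  | induction : Axiom k
      (all eps nu (all eps nv (subE vE uE ⊃ₒ .var (eps ⇒ omicron) np ⬝ vE) ⊃ₒ
          .var (eps ⇒ omicron) np ⬝ uE) ⊃ₒ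
        all eps nu (.var (eps ⇒ omicron) np ⬝ uE))
  -- is-free-in
  | freeVar : Axiom k (isVar xE ⊃ₒ isFreeIn xE xE)
  | freeVarNe : Axiom k (isVar xE ⋏ isVar yE ⋏ xE ≐̸ yE ⊃ₒ neg (isFreeIn xE yE))
  | freeCon : Axiom k (isVar xE ⋏ isCon yE ⊃ₒ neg (isFreeIn xE yE))
  | freeApp : Axiom k
      (isVar xE ⋏ isExpr (appE yE zE) ⊃ₒ
        (isFreeIn xE (appE yE zE) ≐ (isFreeIn xE yE ⋎ isFreeIn xE zE)))
  | freeAbsNe : Axiom k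
      (isVar xE ⋏ isExpr (absE yE zE) ⋏ xE ≐̸ yE ⊃ₒ
        (isFreeIn xE (absE yE zE) ≐ isFreeIn xE zE))
  | freeAbs : Axiom k (isExpr (absE xE yE) ⊃ₒ neg (isFreeIn xE (absE xE yE)))
  | freeQuo : Axiom k (isVar xE ⋏ isExpr yE ⊃ₒ neg (isFreeIn xE (quoE yE)))
  | freeNot : Axiom k (neg (isVar xE) ⋎ neg (isExpr yE) ⊃ₒ neg (isFreeIn xE yE))
  -- quotation
  | quoteApp {α β : Ty} (F : EFExpr (α ⇒ β)) (A : EFExpr α) : Axiom k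
      (Expr.quo (.app F A) ≐ appE (.quo F) (.quo A))
  | quoteLam {β : Ty} (α : Ty) (n : ℕ) (B : EFExpr β) : Axiom k
      (Expr.quo (.lam α n B) ≐ absE (qvar α n) (.quo B))
  | quoteQuo {α : Ty} (A : EFExpr α) : Axiom k
      (Expr.quo (.quo A) ≐ quoE (.quo A))
  | betaQuo {α β : Ty} (n : ℕ) (B : EFExpr β) (A : Expr α) : Axiom k
      (Expr.lam α n (.quo B) ⬝ A ≐ .quo B)
  -- evaluation
  | evalVar {α : Ty} (n : ℕ) (T : Expr α) : Axiom k (Expr.eval (qvar α n) T ≐ .var α n)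
  | evalCon {α : Ty} (c : Const α) (T : Expr α) : Axiom k (Expr.eval (qcon c) T ≐ .con c)
  | evalApp {α β : Ty} (A B : Expr eps) (S : Expr (α ⇒ β)) (T : Expr α) (U : Expr β) : Axiom k
      (isExprOf (α ⇒ β) A ⋏ isExprOf α B ⊃ₒ
        Expr.eval (appE A B) U ≐ Expr.eval A S ⬝ Expr.eval B T)
  | evalAbs {α β : Ty} (n : ℕ) (A : EFExpr eps) (S : Expr (α ⇒ β)) (T : Expr β) : Axiom k
      (isExprOf β A.toExpr ⋏ neg (isFreeIn (qvar α n) (.quo A)) ⊃ₒ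
        Expr.eval (absE (qvar α n) A.toExpr) S ≐ .lam α n (Expr.eval A.toExpr T))
  | evalQuo (A : Expr eps) (T : Expr eps) : Axiom k
      (isExprOf eps A ⊃ₒ Expr.eval (quoE A) T ≐ A)
  | betaEvalSame {β : Ty} (α : Ty) (n : ℕ) (B : Expr eps) (T : Expr β) : Axiom k
      (Expr.lam α n (.eval B T) ⬝ .var α n ≐ .eval B T)
  | betaEval {α β : Ty} (n : ℕ) (B : Expr eps) (T : Expr β) (A : Expr α) : Axiom k
      (isExprOf β (Expr.lam α n B ⬝ A) ⋏ neg (isFreeIn (qvar α n) (Expr.lam α n B ⬝ A)) ⊃ₒ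
        Expr.lam α n (.eval B T) ⬝ A ≐ .eval (Expr.lam α n B ⬝ A) T)
  -- effectiveness
  | notFreeNotEffective {α β : Ty} {n m : ℕ} (hm : m ≠ n) (B : EFExpr β)
      (hfree : ¬FreeIn α n B) : Axiom k (neg (isEffectiveIn α n m B.toExpr))
  | betaLamPointwise {α β γ : Ty} {n m i j : ℕ} (hk : k = .pointwise) (B : Expr γ) (A : Expr α)
      (h : ¬(α = β ∧ n = m)) (hi : i ≠ m) (hj : j ≠ n) : Axiom k
      (neg (isEffectiveIn β m i A) ⋎ neg (isEffectiveIn α n j B) ⊃ₒ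
        Expr.lam α n (.lam β m B) ⬝ A ≐ .lam β m (Expr.lam α n B ⬝ A))
  | betaLamUniform {α β γ : Ty} {n m i j : ℕ} (hk : k = .uniform) (B : Expr γ) (A : Expr α)
      (h : ¬(α = β ∧ n = m)) (hi : i ≠ m) (hj : j ≠ n) : Axiom k
      (all β m (neg (isEffectiveIn β m i A)) ⋎
          all β m (all α n (neg (isEffectiveIn α n j B))) ⊃ₒ
        Expr.lam α n (.lam β m B) ⬝ A ≐ .lam β m (Expr.lam α n B ⬝ A))

/-- The set of logical constants. -/
inductive IsLogical : Sym → Prop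
  | eq (α : Ty) : IsLogical ⟨_, .eq α⟩
  | isVar : IsLogical ⟨_, .isVar⟩
  | isVarOf (α : Ty) : IsLogical ⟨_, .isVarOf α⟩
  | isCon : IsLogical ⟨_, .isCon⟩
  | isConOf (α : Ty) : IsLogical ⟨_, .isConOf α⟩
  | app : IsLogical ⟨_, .app⟩
  | abs : IsLogical ⟨_, .abs⟩
  | quo : IsLogical ⟨_, .quo⟩
  | isExpr : IsLogical ⟨_, .isExpr⟩
  | isExprOf (α : Ty) : IsLogical ⟨_, .isExprOf α⟩
  | sub : IsLogical ⟨_, .sub⟩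
  | isFreeIn : IsLogical ⟨_, .isFreeIn⟩

/-- A theory: a language, given by a set of constants that contains the logical ones, and a set of
formulas of that language. -/
structure Theory where
  consts : Set Sym
  logical : ∀ c, IsLogical c → c ∈ consts
  axioms : Set Formula
  inLang : ∀ A ∈ axioms, A.InLang consts

/-- `T` is extended by `T'`: every constant and every axiom of `T` belongs to `T'`. -/
def Theory.Extends (T' T : Theory) : Prop := T.consts ⊆ T'.consts ∧ T.axioms ⊆ T'.axioms

/-- `Proves k T A`: `A` is a theorem of `T`, i.e. it is obtained from the logical axioms that are
formulas of the language of `T` and the members of `T.axioms` by finitely many applications of the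
rule of equality substitution. -/
inductive Proves (k : EffectForm) (T : Theory) : Formula → Prop
  | logicalAxiom {A : Formula} : Axiom k A → A.InLang T.consts → Proves k T A
  | theoryAxiom {A : Formula} : A ∈ T.axioms → Proves k T A
  | ruleR {α : Ty} {A B : Expr α} {C C' : Formula} :
      Proves k T (A ≐ B) → Proves k T C → ReplaceOne A B C C' → Proves k T C'

/-! ## Quasiquotation -/

/-- Quasi-expressions: expressions without evaluations in which some parts have been replaced by
antiquotations. -/
inductive QuasiExpr : Type
  | anti (A : Expr eps) : QuasiExpr
  | var (α : Ty) (n : ℕ) : QuasiExpr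
  | con {α : Ty} (c : Const α) : QuasiExpr
  | app (M N : QuasiExpr) : QuasiExpr
  | lam (α : Ty) (n : ℕ) (N : QuasiExpr) : QuasiExpr
  | lamAnti (A : Expr eps) (N : QuasiExpr) : QuasiExpr
  | quo (M : QuasiExpr) : QuasiExpr

/-- The expression that the quasiquotation of a quasi-expression stands for. -/
def QuasiExpr.quasiquote : QuasiExpr → Expr eps
  | .anti A => A
  | .var α n => qvar α n
  | .con c => qcon c
  | .app M N => appE M.quasiquote N.quasiquote
  | .lam α n N => absE (qvar α n) N.quasiquote
  | .lamAnti A N => absE A N.quasiquote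
  | .quo M => quoE M.quasiquote

/-! ## The theory of the real numbers with differentiation of polynomials -/

abbrev zeroI : Expr iota := .con .zero
abbrev oneI : Expr iota := .con .one
def negI (A : Expr iota) : Expr iota := .con .neg ⬝ A
def addI (A B : Expr iota) : Expr iota := .con .add ⬝ A ⬝ B
def mulI (A B : Expr iota) : Expr iota := .con .mul ⬝ A ⬝ B
def invI (A : Expr iota) : Expr iota := .con .inv ⬝ A
def posI (A : Expr iota) : Formula := .con .pos ⬝ A
def ltI (A B : Expr iota) : Formula := .con .lt ⬝ A ⬝ B
def leI (A B : Expr iota) : Formula := .con .le ⬝ A ⬝ B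
def ubI (A : Expr iota) (S : Expr (iota ⇒ omicron)) : Formula := .con .ub ⬝ A ⬝ S
def lubI (A : Expr iota) (S : Expr (iota ⇒ omicron)) : Formula := .con .lub ⬝ A ⬝ S
def derivF (F : Expr (iota ⇒ iota)) : Expr (iota ⇒ iota) := .con .deriv ⬝ F
def isDiffF (F : Expr (iota ⇒ iota)) : Formula := .con .isDiff ⬝ F
def isPoly (A : Expr eps) : Formula := .con .isPoly ⬝ A
def polyDiff (A B : Expr eps) : Expr eps := .con .polyDiff ⬝ A ⬝ B

/-- `2` stands for `1 + 1`. -/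
def twoI : Expr iota := addI oneI oneI

/-- `A ^ 0` stands for `1`, and `A ^ (m + 1)` for `A ^ m * A`. -/
def powI (A : Expr iota) : ℕ → Expr iota
  | 0 => oneI
  | m + 1 => mulI (powI A m) A

abbrev uI : Expr iota := .var iota nu
abbrev vI : Expr iota := .var iota nv
abbrev wI : Expr iota := .var iota nw
abbrev xI : Expr iota := .var iota nx
abbrev yI : Expr iota := .var iota ny
abbrev zI : Expr iota := .var iota nz
abbrev fF : Expr (iota ⇒ iota) := .var (iota ⇒ iota) nf
abbrev gF : Expr (iota ⇒ iota) := .var (iota ⇒ iota) ng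
abbrev pS : Expr (iota ⇒ omicron) := .var (iota ⇒ omicron) np

/-- The quasiquotations `⌜-⌞A⌟⌝`, `⌜⌞A⌟ + ⌞B⌟⌝` and `⌜⌞A⌟ * ⌞B⌟⌝`. -/
def qneg (A : Expr eps) : Expr eps := (QuasiExpr.app (.con .neg) (.anti A)).quasiquote
def qadd (A B : Expr eps) : Expr eps :=
  (QuasiExpr.app (.app (.con .add) (.anti A)) (.anti B)).quasiquote
def qmul (A B : Expr eps) : Expr eps :=
  (QuasiExpr.app (.app (.con .mul) (.anti A)) (.anti B)).quasiquote

/-- "`D` is the derivative of `F` at `A`": for every `u > 0` there is `v > 0` such that, for all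
`w ≠ 0` with `-v < w < v`, the number `(F (A + w) - F A) / w - D` lies strictly between `-u` and
`u`. The variables `u`, `v`, `w` of type `iota` must not be free in `F`, `A`, `D`. -/
def hasDeriv (F : Expr (iota ⇒ iota)) (A D : Expr iota) : Formula :=
  all iota nu (posI uI ⊃ₒ ex iota nv (posI vI ⋏ all iota nw
    (wI ≐̸ zeroI ⋏ ltI (negI vI) wI ⋏ ltI wI vI ⊃ₒ
      ltI (negI uI)
        (addI (mulI (addI (F ⬝ addI A wI) (negI (F ⬝ A))) (invI wI)) (negI D)) ⋏
      ltI (addI (mulI (addI (F ⬝ addI A wI) (negI (F ⬝ A))) (invI wI)) (negI D)) uI)))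

/-- The nonlogical axioms. Free variables are implicitly universally quantified. -/
inductive RealAxiom : Formula → Prop
  -- `iota` is a field
  | addAssoc : RealAxiom (addI (addI xI yI) zI ≐ addI xI (addI yI zI))
  | addComm : RealAxiom (addI xI yI ≐ addI yI xI)
  | addZero : RealAxiom (addI xI zeroI ≐ xI)
  | addNeg : RealAxiom (addI xI (negI xI) ≐ zeroI)
  | mulAssoc : RealAxiom (mulI (mulI xI yI) zI ≐ mulI xI (mulI yI zI))
  | mulComm : RealAxiom (mulI xI yI ≐ mulI yI xI)
  | mulOne : RealAxiom (mulI xI oneI ≐ xI)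
  | mulInv : RealAxiom (xI ≐̸ zeroI ⊃ₒ mulI xI (invI xI) ≐ oneI)
  | zeroNeOne : RealAxiom (zeroI ≐̸ oneI)
  | distrib : RealAxiom (mulI xI (addI yI zI) ≐ addI (mulI xI yI) (mulI xI zI))
  -- the field is ordered, with positive elements `pos`
  | trichotomy : RealAxiom
      ((xI ≐ zeroI ⋏ neg (posI xI) ⋏ neg (posI (negI xI))) ⋎
        (xI ≐̸ zeroI ⋏ posI xI ⋏ neg (posI (negI xI))) ⋎
        (xI ≐̸ zeroI ⋏ neg (posI xI) ⋏ posI (negI xI)))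
  | posAdd : RealAxiom (posI xI ⋏ posI yI ⊃ₒ posI (addI xI yI))
  | posMul : RealAxiom (posI xI ⋏ posI yI ⊃ₒ posI (mulI xI yI))
  | ltDef : RealAxiom (ltI xI yI ≐ posI (addI yI (negI xI)))
  | leDef : RealAxiom (leI xI yI ≐ (ltI xI yI ⋎ xI ≐ yI))
  -- the ordered field is complete
  | ubDef : RealAxiom (ubI xI pS ≐ all iota ny (pS ⬝ yI ⊃ₒ leI yI xI))
  | lubDef : RealAxiom (lubI xI pS ≐ (ubI xI pS ⋏ all iota ny (ubI yI pS ⊃ₒ leI xI yI)))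
  | complete : RealAxiom
      (ex iota nx (pS ⬝ xI) ⋏ ex iota nx (ubI xI pS) ⊃ₒ ex iota nx (lubI xI pS))
  -- negation, addition and multiplication of functions
  | fnegDef : RealAxiom (.con .fneg ⬝ fF ≐ .lam iota nx (negI (fF ⬝ xI)))
  | faddDef : RealAxiom
      (.con .fadd ⬝ fF ⬝ gF ≐ .lam iota nx (addI (fF ⬝ xI) (gF ⬝ xI)))
  | fmulDef : RealAxiom
      (.con .fmul ⬝ fF ⬝ gF ≐ .lam iota nx (mulI (fF ⬝ xI) (gF ⬝ xI)))
  -- differentiability and the derivative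
  | isDiffDef : RealAxiom (isDiffF fF ≐ all iota nx (ex iota ny (hasDeriv fF xI yI)))
  | derivSpec : RealAxiom (isDiffF fF ⊃ₒ all iota nx (hasDeriv fF xI (derivF fF ⬝ xI)))
  -- polynomials
  | isPolyDef : RealAxiom
      (.con .isPoly ≐ .lam eps nu
        (uE ≐ qvar iota nx ⋎ uE ≐ qvar iota ny ⋎ uE ≐ qcon .zero ⋎ uE ≐ qcon .one ⋎
          ex eps nv (isPoly vE ⋏ uE ≐ qneg vE) ⋎
          ex eps nv (ex eps nw (isPoly vE ⋏ isPoly wE ⋏ uE ≐ qadd vE wE)) ⋎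
          ex eps nv (ex eps nw (isPoly vE ⋏ isPoly wE ⋏ uE ≐ qmul vE wE))))
  -- symbolic differentiation of polynomials
  | polyDiffVar : RealAxiom (isVarOf iota xE ⊃ₒ polyDiff xE xE ≐ qcon .one)
  | polyDiffVarNe : RealAxiom
      (isVarOf iota xE ⋏ isVarOf iota yE ⋏ xE ≐̸ yE ⊃ₒ polyDiff xE yE ≐ qcon .zero)
  | polyDiffCon : RealAxiom
      (isConOf iota xE ⋏ isVarOf iota yE ⊃ₒ polyDiff xE yE ≐ qcon .zero)
  | polyDiffNeg : RealAxiom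
      (isPoly xE ⋏ isVarOf iota yE ⊃ₒ polyDiff (qneg xE) yE ≐ qneg (polyDiff xE yE))
  | polyDiffAdd : RealAxiom
      (isPoly xE ⋏ isPoly yE ⋏ isVarOf iota zE ⊃ₒ
        polyDiff (qadd xE yE) zE ≐ qadd (polyDiff xE zE) (polyDiff yE zE))
  | polyDiffMul : RealAxiom
      (isPoly xE ⋏ isPoly yE ⋏ isVarOf iota zE ⊃ₒ
        polyDiff (qmul xE yE) zE ≐ qadd (qmul (polyDiff xE zE) yE) (qmul xE (polyDiff yE zE)))

/-- The constant is one of the `other` ones. -/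
def Const.IsOther : {α : Ty} → Const α → Prop
  | _, .other _ _ => True
  | _, _ => False

/-- The constants of the theory of the real numbers: all constants except the `other` ones. -/
def realConsts : Set Sym := {c | ¬c.2.IsOther}

theorem isLogical_mem_realConsts (c : Sym) (h : IsLogical c) : c ∈ realConsts := by
  cases h <;> exact id

theorem realAxiom_inLang (A : Formula) (h : RealAxiom A) : A.InLang realConsts := by
  cases h <;> simp [Expr.InLang, EFExpr.InLang, realConsts, Const.IsOther, eqn, tt, ff, all, andC, conj, impC, imp,
    notC, neg, orC, disj, ex, neqn, qvar, qcon, isVarOf, isConOf, appE, negI, addI, mulI, invI,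
    posI, ltI, leI, ubI, lubI, derivF, isDiffF, isPoly, polyDiff, qneg, qadd, qmul, hasDeriv,
    QuasiExpr.quasiquote]

/-- The theory of the real numbers with differentiation of polynomials. -/
def realTheory : Theory where
  consts := realConsts
  logical := isLogical_mem_realConsts
  axioms := {A | RealAxiom A}
  inLang := realAxiom_inLang

end CTTqe

namespace CTTqe
open Ty

/-! For w ≠ 0 the difference quotient of the square at x, minus a candidate slope D, equals w + 2x −
D. With D = 2x this is w, so v = u proves differentiability. Conversely put E = 2x − D. If E > 0,
the bound u = E fails at w = v/2; if E < 0, the bound u = −E fails at w = −v/2. Hence 2x is the only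
derivative at x, the specification of `deriv` forces `deriv` of the square at x to be 2x, and
extensionality turns this into an equation of functions. Neither completeness of the field nor
symbolic differentiation is needed.

The work lies in carrying this out inside the calculus. All formulas are kept eval-free: `Thm` pairs
derivability with `Plain`. For such formulas beta-reduction under a binder is covered by the two
axioms with syntactic side conditions, so `Thm.beta` performs full capture-free substitution without
any axiom on effectiveness. This is why one argument serves both systems.

On this base the usual development of Andrews' logic goes through: generalization, modus ponens,
case distinction on truth values (`Thm.cases`) and tautologies (`Thm.taut`). Hypotheses are handled
by `Entails`, where a context is the antecedent of an implication, and equality under hypotheses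
comes from Leibniz' law. Finally the terms of type ι modulo equality provable from a context form a
commutative ring, `TermRing`, so algebra inside the theory becomes ring identities between classes.
`Entails.cls_slopeError` and `Entails.hasDeriv_sqF_unique` carry the analysis. -/

variable {k : EffectForm} {T : Theory} {α β γ : Ty}

/-! ## Eval-free expressions of a language, free variables and substitution -/

/-- `A` is an eval-free expression all of whose constants belong to `D`. -/
def Expr.Plain (D : Set Sym) : {α : Ty} → Expr α → Prop
  | _, .var _ _ => True
  | α, .con c => (⟨α, c⟩ : Sym) ∈ D
  | _, .app F A => F.Plain D ∧ A.Plain D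
  | _, .lam _ _ B => B.Plain D
  | _, .quo A => A.InLang D
  | _, .eval _ _ => False

/-- The variable `var α n` is free in `B` (outside of evaluations). -/
def Occurs (α : Ty) (n : ℕ) : {β : Ty} → Expr β → Prop
  | _, .var β m => α = β ∧ n = m
  | _, .con _ => False
  | _, .app F A => Occurs α n F ∨ Occurs α n A
  | _, .lam β m B => ¬(α = β ∧ n = m) ∧ Occurs α n B
  | _, .quo _ => False
  | _, .eval _ _ => False

/-- `Subst n A B B'`: `B'` results from `B` by substituting `A` for the free occurrences of
`var α n`, and no free variable of `A` is captured. -/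
inductive Subst {α : Ty} (n : ℕ) (A : Expr α) : {β : Ty} → Expr β → Expr β → Prop
  | varSame : Subst n A (.var α n) A
  | varNe {β : Ty} {m : ℕ} (h : ¬(α = β ∧ n = m) := by simp) :
      Subst n A (.var β m) (.var β m)
  | con {β : Ty} {c : Const β} : Subst n A (.con c) (.con c)
  | quo {β : Ty} {B : EFExpr β} : Subst n A (.quo B) (.quo B)
  | app {β γ : Ty} {F F' : Expr (β ⇒ γ)} {B B' : Expr β} :
      Subst n A F F' → Subst n A B B' → Subst n A (F ⬝ B) (F' ⬝ B')
  | lamSame {β : Ty} {B : Expr β} : Subst n A (.lam α n B) (.lam α n B)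
  | lam {β γ : Ty} {m : ℕ} {B B' : Expr γ} (h : ¬(α = β ∧ n = m))
      (hf : ¬Occurs β m A ∨ ¬Occurs α n B) :
      Subst n A B B' → Subst n A (.lam β m B) (.lam β m B')

theorem EFExpr.occurs_toExpr {n : ℕ} (A : EFExpr β) :
    Occurs α n A.toExpr ↔ FreeIn α n A := by
  induction A <;> simp_all [EFExpr.toExpr, Occurs, FreeIn]

theorem Expr.Plain.exists_toExpr {D : Set Sym} {A : Expr α} (h : A.Plain D) :
    ∃ A' : EFExpr α, A'.toExpr = A := by
  induction A with
  | var α n => exact ⟨.var α n, rfl⟩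
  | con c => exact ⟨.con c, rfl⟩
  | app F A ihF ihA =>
    obtain ⟨F', rfl⟩ := ihF h.1
    obtain ⟨A', rfl⟩ := ihA h.2
    exact ⟨.app F' A', rfl⟩
  | lam α n B ih =>
    obtain ⟨B', rfl⟩ := ih h
    exact ⟨.lam α n B', rfl⟩
  | quo A => exact ⟨.quo A, rfl⟩
  | eval A B => exact h.elim

theorem Expr.Plain.inLang {D : Set Sym} {A : Expr α} (h : A.Plain D) : A.InLang D := by
  induction A with
  | eval A B => exact h.elim
  | _ => simp_all [Expr.Plain, Expr.InLang]

/-- One bound serves all types at once, so a fresh variable of any type can be chosen by its number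
alone. -/
theorem Expr.exists_not_occurs (A : Expr β) : ∃ N, ∀ m, N ≤ m → ∀ α, ¬Occurs α m A := by
  induction A with
  | var β n => exact ⟨n + 1, fun m hm α h => by have := h.2; omega⟩
  | app F A ihF ihA =>
    obtain ⟨N, hN⟩ := ihF
    obtain ⟨M, hM⟩ := ihA
    refine ⟨max N M, fun m hm α h => ?_⟩
    rcases h with h | h
    · exact hN m (by omega) α h
    · exact hM m (by omega) α h
  | lam β n B ih =>
    obtain ⟨N, hN⟩ := ih
    exact ⟨N, fun m hm α h => hN m hm α h.2⟩
  | _ => exact ⟨0, fun m _ α h => h⟩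

theorem Subst.of_not_occurs {D : Set Sym} {n : ℕ} {A : Expr α} {B : Expr β} (hB : B.Plain D)
    (h : ¬Occurs α n B) : Subst n A B B := by
  induction B with
  | var β m => exact .varNe h
  | con c => exact .con
  | app F C ihF ihC =>
    simp only [Occurs, not_or] at h
    exact .app (ihF hB.1 h.1) (ihC hB.2 h.2)
  | lam β m B ih =>
    by_cases hs : α = β ∧ n = m
    · obtain ⟨rfl, rfl⟩ := hs
      exact .lamSame
    · have : ¬Occurs α n B := fun ho => h ⟨hs, ho⟩
      exact .lam hs (.inr this) (ih hB this)
  | quo B => exact .quo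
  | eval B C => exact hB.elim

/-- Used to contract `(λ x. B) x` to `B`: a binder of another variable cannot capture x, and a
binder of x itself stops the substitution. -/
theorem Subst.self {D : Set Sym} {n : ℕ} {B : Expr β} (hB : B.Plain D) :
    Subst n (.var α n) B B := by
  induction B with
  | var β m =>
    by_cases hs : α = β ∧ n = m
    · obtain ⟨rfl, rfl⟩ := hs
      exact .varSame
    · exact .varNe hs
  | con c => exact .con
  | app F C ihF ihC => exact .app (ihF hB.1) (ihC hB.2)
  | lam β m B ih =>
    by_cases hs : α = β ∧ n = m
    · obtain ⟨rfl, rfl⟩ := hs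
      exact .lamSame
    · exact .lam hs (.inl fun ho => hs ⟨ho.1.symm, ho.2.symm⟩) (ih hB)
  | quo B => exact .quo
  | eval B C => exact hB.elim

theorem Subst.plain {D : Set Sym} {n : ℕ} {A : Expr α} {B B' : Expr β} (h : Subst n A B B')
    (hA : A.Plain D) (hB : B.Plain D) : B'.Plain D := by
  induction h with
  | varSame => exact hA
  | app _ _ ih1 ih2 => exact ⟨ih1 hB.1, ih2 hB.2⟩
  | lam _ _ _ ih => exact ih hB
  | _ => exact hB

/-! Plainness of, and free variables in, compound expressions. -/

section Connectives

variable {n m : ℕ} {A B : Formula}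

@[simp] theorem plain_var {D : Set Sym} : (Expr.var α n).Plain D := trivial

@[simp] theorem plain_app {D : Set Sym} {F : Expr (α ⇒ β)} {C : Expr α} :
    (F ⬝ C).Plain D ↔ F.Plain D ∧ C.Plain D := Iff.rfl

@[simp] theorem plain_lam {D : Set Sym} {C : Expr β} :
    (Expr.lam α n C).Plain D ↔ C.Plain D := Iff.rfl

@[simp] theorem plain_eq : (Expr.con (.eq α)).Plain T.consts := T.logical _ (.eq α)

@[simp] theorem plain_eqn {C E : Expr α} :
    (C ≐ E).Plain T.consts ↔ C.Plain T.consts ∧ E.Plain T.consts := by simp [eqn]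

@[simp] theorem plain_tt : tt.Plain T.consts := by simp [tt]

@[simp] theorem plain_ff : ff.Plain T.consts := by simp [ff]

@[simp] theorem plain_all : (all α n A).Plain T.consts ↔ A.Plain T.consts := by simp [all]

@[simp] theorem plain_andC : andC.Plain T.consts := by simp [andC]

@[simp] theorem plain_conj :
    (A ⋏ B).Plain T.consts ↔ A.Plain T.consts ∧ B.Plain T.consts := by simp [conj]

@[simp] theorem plain_impC : impC.Plain T.consts := by simp [impC]

@[simp] theorem plain_imp :
    (A ⊃ₒ B).Plain T.consts ↔ A.Plain T.consts ∧ B.Plain T.consts := by simp [imp]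

@[simp] theorem plain_neg : (neg A).Plain T.consts ↔ A.Plain T.consts := by simp [neg, notC]

@[simp] theorem plain_orC : orC.Plain T.consts := by simp [orC]

@[simp] theorem plain_disj :
    (A ⋎ B).Plain T.consts ↔ A.Plain T.consts ∧ B.Plain T.consts := by simp [disj]

@[simp] theorem plain_ex : (ex α n A).Plain T.consts ↔ A.Plain T.consts := by simp [ex]

@[simp] theorem plain_neqn {C E : Expr α} :
    (C ≐̸ E).Plain T.consts ↔ C.Plain T.consts ∧ E.Plain T.consts := by simp [neqn]

@[simp] theorem occurs_var : Occurs α n (.var β m) ↔ α = β ∧ n = m := Iff.rfl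

@[simp] theorem occurs_con {c : Const β} : ¬Occurs α n (.con c) := id

@[simp] theorem occurs_app {F : Expr (β ⇒ γ)} {C : Expr β} :
    Occurs α n (F ⬝ C) ↔ Occurs α n F ∨ Occurs α n C := Iff.rfl

@[simp] theorem occurs_lam {C : Expr γ} :
    Occurs α n (.lam β m C) ↔ ¬(α = β ∧ n = m) ∧ Occurs α n C := Iff.rfl

@[simp] theorem occurs_eqn {C E : Expr β} :
    Occurs α n (C ≐ E) ↔ Occurs α n C ∨ Occurs α n E := by simp [eqn]

@[simp] theorem occurs_tt : ¬Occurs α n tt := by simp [tt]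

@[simp] theorem occurs_ff : ¬Occurs α n ff := by simp [ff]

@[simp] theorem occurs_all :
    Occurs α n (all β m A) ↔ ¬(α = β ∧ n = m) ∧ Occurs α n A := by simp [all]

@[simp] theorem occurs_andC : ¬Occurs α n andC := by simp [andC]; tauto

@[simp] theorem occurs_conj : Occurs α n (A ⋏ B) ↔ Occurs α n A ∨ Occurs α n B := by simp [conj]

@[simp] theorem occurs_impC : ¬Occurs α n impC := by simp [impC]; tauto

@[simp] theorem occurs_imp : Occurs α n (A ⊃ₒ B) ↔ Occurs α n A ∨ Occurs α n B := by simp [imp]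

@[simp] theorem occurs_neg : Occurs α n (neg A) ↔ Occurs α n A := by simp [neg, notC]

@[simp] theorem occurs_orC : ¬Occurs α n orC := by simp [orC]; tauto

@[simp] theorem occurs_ex :
    Occurs α n (ex β m A) ↔ ¬(α = β ∧ n = m) ∧ Occurs α n A := by simp [ex]

end Connectives

/-! ### Substitution through the defined connectives -/

namespace Subst

variable {n m : ℕ} {X : Expr α} {A A' B B' : Formula}

theorem eqn {C C' E E' : Expr β} (h₁ : Subst n X C C') (h₂ : Subst n X E E') :
    Subst n X (C ≐ E) (C' ≐ E') := .app (.app .con h₁) h₂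

theorem tt : Subst n X CTTqe.tt CTTqe.tt := .eqn .con .con

theorem ff : Subst n X CTTqe.ff CTTqe.ff :=
  -- Any theory would do here: only the absence of evaluations matters.
  .of_not_occurs (plain_ff (T := realTheory)) occurs_ff

theorem all (h : ¬(α = β ∧ n = m)) (hf : ¬Occurs β m X) (hA : Subst n X A A') :
    Subst n X (CTTqe.all β m A) (CTTqe.all β m A') :=
  .eqn (.lam h (.inl hf) .tt) (.lam h (.inl hf) hA)

theorem conj (h₁ : Subst n X A A') (h₂ : Subst n X B B') : Subst n X (A ⋏ B) (A' ⋏ B') :=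
  .app (.app (.of_not_occurs (plain_andC (T := realTheory)) occurs_andC) h₁) h₂

theorem imp (h₁ : Subst n X A A') (h₂ : Subst n X B B') : Subst n X (A ⊃ₒ B) (A' ⊃ₒ B') :=
  .app (.app (.of_not_occurs (plain_impC (T := realTheory)) occurs_impC) h₁) h₂

theorem neg (h : Subst n X A A') : Subst n X (CTTqe.neg A) (CTTqe.neg A') :=
  .app (.app .con .ff) h

theorem disj (h₁ : Subst n X A A') (h₂ : Subst n X B B') : Subst n X (A ⋎ B) (A' ⋎ B') :=
  .app (.app (.of_not_occurs (plain_orC (T := realTheory)) occurs_orC) h₁) h₂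

theorem ex (h : ¬(α = β ∧ n = m)) (hf : ¬Occurs β m X) (hA : Subst n X A A') :
    Subst n X (CTTqe.ex β m A) (CTTqe.ex β m A') := .neg (.all h hf (.neg hA))

theorem neqn {C C' E E' : Expr β} (h₁ : Subst n X C C') (h₂ : Subst n X E E') :
    Subst n X (C ≐̸ E) (C' ≐̸ E') := .neg (.eqn h₁ h₂)

end Subst

/-! ## Equational reasoning -/

/-- `A` is an eval-free theorem of `T`. -/
structure Thm (k : EffectForm) (T : Theory) (A : Formula) : Prop where
  plain : A.Plain T.consts
  proves : Proves k T A

namespace Thm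

theorem ofAxiom {A : Formula} (h : Axiom k A) (hA : A.Plain T.consts) : Thm k T A :=
  ⟨hA, .logicalAxiom h hA.inLang⟩

section

variable {A B C E : Expr α} {n m : ℕ}

theorem plain_left (h : Thm k T (A ≐ B)) : A.Plain T.consts := (plain_eqn.1 h.plain).1

theorem plain_right (h : Thm k T (A ≐ B)) : B.Plain T.consts := (plain_eqn.1 h.plain).2

/-- The beta axiom `(λ x. x) A = A`, used to rewrite its own left side, leaves `A = A`. -/
theorem refl (hA : A.Plain T.consts) : Thm k T (A ≐ A) :=
  have b : Thm k T (Expr.lam α 0 (.var α 0) ⬝ A ≐ A) := ofAxiom (.betaVar 0 A) (by simp [hA])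
  ⟨by simp [hA], .ruleR b.2 b.2 (.appLeft _ (.appRight _ .here))⟩

theorem eqMp {A B : Formula} (h : Thm k T (A ≐ B)) (hA : Thm k T A) : Thm k T B :=
  ⟨h.plain_right, .ruleR h.2 hA.2 .here⟩

theorem symm (h : Thm k T (A ≐ B)) : Thm k T (B ≐ A) :=
  ⟨by simp [h.plain_left, h.plain_right],
    .ruleR h.2 (refl h.plain_left).2 (.appLeft _ (.appRight _ .here))⟩

theorem trans (h₁ : Thm k T (A ≐ B)) (h₂ : Thm k T (B ≐ C)) : Thm k T (A ≐ C) :=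
  ⟨by simp [h₁.plain_left, h₂.plain_right], .ruleR h₂.2 h₁.2 (.appRight _ .here)⟩

theorem congr {F G : Expr (α ⇒ β)} (h₁ : Thm k T (F ≐ G)) (h₂ : Thm k T (A ≐ B)) :
    Thm k T (F ⬝ A ≐ G ⬝ B) :=
  ⟨by simp [h₁.plain_left, h₂.plain_left, h₁.plain_right, h₂.plain_right],
    .ruleR h₂.2 (.ruleR h₁.2 (refl (plain_app.2 ⟨h₁.plain_left, h₂.plain_left⟩)).2
      (.appRight _ (.appLeft _ .here))) (.appRight _ (.appRight _ .here))⟩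

theorem congrLam (n : ℕ) (h : Thm k T (A ≐ B)) :
    Thm k T (Expr.lam β n A ≐ .lam β n B) :=
  ⟨by simp [h.plain_left, h.plain_right],
    .ruleR h.2 (refl (plain_lam.2 h.plain_left)).2 (.appRight _ (.lam _ _ .here))⟩

theorem congrEqn (h₁ : Thm k T (A ≐ B)) (h₂ : Thm k T (C ≐ E)) :
    Thm k T ((A ≐ C) ≐ (B ≐ E)) := congr (congr (refl plain_eq) h₁) h₂

end

section

variable {A B C E : Formula} {n : ℕ}

theorem congrConj (h₁ : Thm k T (A ≐ B)) (h₂ : Thm k T (C ≐ E)) :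
    Thm k T ((A ⋏ C) ≐ (B ⋏ E)) := congr (congr (refl plain_andC) h₁) h₂

theorem congrImp (h₁ : Thm k T (A ≐ B)) (h₂ : Thm k T (C ≐ E)) :
    Thm k T ((A ⊃ₒ C) ≐ (B ⊃ₒ E)) := congr (congr (refl plain_impC) h₁) h₂

theorem congrDisj (h₁ : Thm k T (A ≐ B)) (h₂ : Thm k T (C ≐ E)) :
    Thm k T ((A ⋎ C) ≐ (B ⋎ E)) := congr (congr (refl plain_orC) h₁) h₂

theorem congrNeg (h : Thm k T (A ≐ B)) : Thm k T (neg A ≐ neg B) :=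
  congrEqn (refl plain_ff) h

theorem congrAll (α : Ty) (n : ℕ) (h : Thm k T (A ≐ B)) : Thm k T (all α n A ≐ all α n B) :=
  congrEqn (refl (plain_lam.2 plain_tt)) (congrLam n h)

end

/-- Each clause of `Subst` matches one beta axiom. Under a foreign binder the two alternatives in
`Subst.lam` select `betaLamArg` or `betaLamBody`; both apply because argument and body are
eval-free. -/
theorem beta {n : ℕ} {A : Expr α} {B B' : Expr β} (h : Subst n A B B')
    (hA : A.Plain T.consts) (hB : B.Plain T.consts) :
    Thm k T (Expr.lam α n B ⬝ A ≐ B') := by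
  induction h with
  | varSame => exact ofAxiom (.betaVar n A) (by simp [hA])
  | varNe h => exact ofAxiom (.betaVarNe A h) (by simp [hA])
  | con => exact ofAxiom (.betaCon n _ A) (by simp [hA, hB])
  | quo => exact ofAxiom (.betaQuo n _ A) (by simp [hA, hB])
  | app h₁ h₂ ih₁ ih₂ =>
    have b : Thm k T _ := ofAxiom (.betaApp n _ _ A) (by
      simp only [plain_eqn, plain_app, plain_lam]
      exact ⟨⟨⟨hB.1, hB.2⟩, hA⟩, ⟨hB.1, hA⟩, hB.2, hA⟩)
    exact b.trans (congr (ih₁ hB.1) (ih₂ hB.2))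
  | lamSame => exact ofAxiom (.betaLamSame n _ A) (by simpa [hA] using hB)
  | @lam β γ m C C' h hf hs ih =>
    have hp : (Expr.lam α n (.lam β m C) ⬝ A ≐ .lam β m (Expr.lam α n C ⬝ A)).Plain T.consts := by
      simpa [hA] using hB
    have b : Thm k T (Expr.lam α n (.lam β m C) ⬝ A ≐ .lam β m (Expr.lam α n C ⬝ A)) := by
      rcases hf with hf | hf
      · obtain ⟨A', rfl⟩ := hA.exists_toExpr
        exact ofAxiom (.betaLamArg _ A' h (mt A'.occurs_toExpr.2 hf)) hp
      · obtain ⟨C', rfl⟩ := Expr.Plain.exists_toExpr (A := C) hB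
        exact ofAxiom (.betaLamBody C' A h (mt C'.occurs_toExpr.2 hf)) hp
    exact b.trans (congrLam m (ih hB))

/-- Abstract both sides over the variable, apply to `A`, contract. This instantiates equations
before any quantifier rule is available. -/
theorem substEqn {n : ℕ} {A : Expr α} {B B' C C' : Expr β} (h : Thm k T (B ≐ C))
    (hB : Subst n A B B') (hC : Subst n A C C') (hA : A.Plain T.consts) :
    Thm k T (B' ≐ C') :=
  (beta hB hA h.plain_left).symm.trans
    ((congr (congrLam n h) (refl hA)).trans (beta hC hA h.plain_right))

theorem ttEqnInst {n : ℕ} {A : Expr α} {B B' : Formula} (h : Thm k T (all α n B))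
    (hB : Subst n A B B') (hA : A.Plain T.consts) : Thm k T (tt ≐ B') :=
  (beta .tt hA plain_tt).symm.trans
    ((congr h (refl hA)).trans (beta hB hA (plain_all.1 h.plain)))

theorem truth : Thm k T tt := refl plain_eq

theorem allElim {n : ℕ} {A : Expr α} {B B' : Formula} (h : Thm k T (all α n B))
    (hB : Subst n A B B') (hA : A.Plain T.consts) : Thm k T B' :=
  (ttEqnInst h hB hA).eqMp truth

/-- Extensionality, for functions in which two particular variables are not free. -/
theorem ext {F G : Expr (α ⇒ β)} (hF : F.Plain T.consts) (hG : G.Plain T.consts)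
    (hFx : ¬Occurs α nx F) (hFg : ¬Occurs (α ⇒ β) ng F) (hGx : ¬Occurs α nx G) :
    Thm k T ((F ≐ G) ≐ all α nx (F ⬝ .var α nx ≐ G ⬝ .var α nx)) := by
  have hne : ¬((α ⇒ β) = α ∧ nf = nx) := by simp
  have hne' : ¬((α ⇒ β) = α ∧ ng = nx) := by simp
  have h₁ := ofAxiom (k := k) (T := T) (.extensionality α β) (by simp)
  -- `F` enters before `G`, so `F` must not contain the variable that is replaced by `G`, while `G`
  -- carries no such restriction.
  have h₂ := h₁.substEqn (n := nf) (A := F) (.eqn .varSame .varNe)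
    (.all hne hFx (.eqn (.app .varSame .varNe) (.app .varNe .varNe))) hF
  exact h₂.substEqn (n := ng) (A := G) (.eqn (.of_not_occurs hF hFg) .varSame)
    (.all hne' hGx (.eqn (.app (.of_not_occurs hF hFg) .varNe) (.app .varSame .varNe))) hG

/-- Passing from a theorem A to `T = A` is not yet possible. For `B = B` extensionality does it: the
identity function equals itself, so `∀ x. (λ x. x) x = (λ x. x) x`, and a universal statement is an
equation with `λ x. T` that can be applied to `B`. -/
theorem ttEqnRefl {B : Expr α} (hB : B.Plain T.consts) : Thm k T (tt ≐ (B ≐ B)) := by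
  have hI : (Expr.lam α nx (.var α nx)).Plain T.consts := by simp
  have h := (ext (k := k) hI hI (by simp) (by simp) (by simp)).eqMp (refl hI)
  have b : Thm k T (Expr.lam α nx (.var α nx) ⬝ B ≐ B) := beta .varSame hB trivial
  exact (h.ttEqnInst (.eqn (.app .lamSame .varSame) (.app .lamSame .varSame)) hB).trans
    (b.congrEqn b)

theorem ttEqn {A B : Expr α} (h : Thm k T (A ≐ B)) : Thm k T (tt ≐ (A ≐ B)) :=
  (ttEqnRefl h.plain_left).trans (congrEqn (refl h.plain_left) h)

/-- The axiom on truth values, for a formula with a distinguished variable. -/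
theorem conjEqnAll {B B₁ B₂ : Formula} (hB : B.Plain T.consts) (h₁ : Subst nx tt B B₁)
    (h₂ : Subst nx ff B B₂) : Thm k T ((B₁ ⋏ B₂) ≐ all omicron nx B) := by
  have h := ofAxiom (k := k) (T := T) .truthValues (by simp)
  have hl : (Expr.lam omicron nx B).Plain T.consts := hB
  have h' := h.substEqn (n := ng) (A := .lam omicron nx B)
    (.conj (.app .varSame .tt) (.app .varSame .ff))
    (.all (by simp) (by simp) (.app .varSame .varNe)) hl
  exact (congrConj (beta h₁ plain_tt hB) (beta h₂ plain_ff hB)).symm.trans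
    (h'.trans (congrAll _ _ (beta (.self hB) trivial hB)))

theorem ttConjTt : Thm k T ((tt ⋏ tt) ≐ tt) :=
  (conjEqnAll plain_tt .tt .tt).trans (ttEqnRefl (plain_lam.2 plain_tt)).symm

theorem ttConjFf : Thm k T ((tt ⋏ ff) ≐ ff) :=
  -- The right side `∀ x. x` is `ff` by definition.
  conjEqnAll (B := .var omicron nx) trivial .varSame .varSame

theorem conjEqns {A B : Expr α} {C E : Expr β} (h₁ : Thm k T (A ≐ B)) (h₂ : Thm k T (C ≐ E)) :
    Thm k T ((A ≐ B) ⋏ (C ≐ E)) :=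
  (congrConj h₁.ttEqn h₂.ttEqn).eqMp (ttConjTt.symm.eqMp truth)

theorem ttConj {A : Formula} (hA : A.Plain T.consts) : Thm k T ((tt ⋏ A) ≐ A) := by
  have h : Thm k T (all omicron nx ((tt ⋏ .var omicron nx) ≐ .var omicron nx)) :=
    (conjEqnAll (by simp) (.eqn (.conj .tt .varSame) .varSame)
      (.eqn (.conj .tt .varSame) .varSame)).eqMp (conjEqns ttConjTt ttConjFf)
  exact h.allElim (.eqn (.conj .tt .varSame) .varSame) hA

/-- Both sides equal `∀ x. (T = x)`: the left one by the axiom on truth values, the right one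
because `ff` is the equation `λ x. T = λ x. x`, to which extensionality applies. -/
theorem ttEqnFf : Thm k T ((tt ≐ ff) ≐ ff) := by
  have h₁ : Thm k T (((tt ≐ tt) ⋏ (tt ≐ ff)) ≐ all omicron nx (tt ≐ .var omicron nx)) :=
    conjEqnAll (by simp) (.eqn .tt .varSame) (.eqn .tt .varSame)
  have h₂ : Thm k T (((tt ≐ tt) ⋏ (tt ≐ ff)) ≐ (tt ≐ ff)) :=
    (congrConj (ttEqnRefl plain_tt).symm (refl (by simp))).trans (ttConj (by simp))
  have h₃ : Thm k T (ff ≐ _) :=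
    ext (F := .lam omicron nx tt) (G := .lam omicron nx (.var omicron nx)) (by simp) (by simp)
      (by simp) (by simp) (by simp)
  have h₄ := h₃.trans (congrAll _ _ (congrEqn (beta .tt trivial plain_tt)
    (beta .varSame trivial trivial)))
  exact h₂.symm.trans (h₁.trans h₄.symm)

/-- It suffices to check the two truth values. This is what allows passing between A and `T = A`, on
which generalization and modus ponens rest. -/
theorem ttEqnEqn {A : Formula} (hA : A.Plain T.consts) : Thm k T ((tt ≐ A) ≐ A) := by
  have h : Thm k T (all omicron nx ((tt ≐ .var omicron nx) ≐ .var omicron nx)) :=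
    (conjEqnAll (by simp) (.eqn (.eqn .tt .varSame) .varSame)
      (.eqn (.eqn .tt .varSame) .varSame)).eqMp (conjEqns (ttEqnRefl plain_tt).symm ttEqnFf)
  exact h.allElim (.eqn (.eqn .tt .varSame) .varSame) hA

theorem eqnTt {A : Formula} (h : Thm k T A) : Thm k T (tt ≐ A) := (ttEqnEqn h.plain).symm.eqMp h

theorem allIntro {A : Formula} (α : Ty) (n : ℕ) (h : Thm k T A) : Thm k T (all α n A) :=
  congrLam n h.eqnTt

theorem subst {n : ℕ} {A : Expr α} {B B' : Formula} (h : Thm k T B) (hB : Subst n A B B')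
    (hA : A.Plain T.consts) : Thm k T B' := (h.allIntro α n).allElim hB hA

/-- Simultaneous substitution for three variables, in a context without capture. -/
theorem inst₃ {Φ : Expr α → Expr β → Expr γ → Formula}
    (hΦ : ∀ {δ : Ty} {n : ℕ} {X : Expr δ} {A A' : Expr α} {B B' : Expr β} {C C' : Expr γ},
      Subst n X A A' → Subst n X B B' → Subst n X C C' → Subst n X (Φ A B C) (Φ A' B' C'))
    {n₁ n₂ n₃ : ℕ} (h : Thm k T (Φ (.var α n₁) (.var β n₂) (.var γ n₃)))
    {A : Expr α} {B : Expr β} {C : Expr γ} (hA : A.Plain T.consts) (hB : B.Plain T.consts)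
    (hC : C.Plain T.consts) (h₁₂ : n₁ ≠ n₂ := by decide) (h₁₃ : n₁ ≠ n₃ := by decide)
    (h₂₃ : n₂ ≠ n₃ := by decide) : Thm k T (Φ A B C) := by
  obtain ⟨a, ha⟩ := A.exists_not_occurs
  obtain ⟨b, hb⟩ := B.exists_not_occurs
  -- The three variables are first renamed to `N`, `N + 1`, `N + 2`, beyond everything in `A` and
  -- `B`. Variables of `C` are harmless because `C` is inserted last.
  obtain ⟨N, hN⟩ : ∃ N, N = a + b + n₁ + n₂ + n₃ + 1 := ⟨_, rfl⟩
  have s₁ := h.subst (A := .var α N) (hΦ .varSame (.varNe (by simp [h₁₂]))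
    (.varNe (by simp [h₁₃]))) plain_var
  have s₂ := s₁.subst (A := .var β (N + 1)) (n := n₂) (hΦ (.varNe (fun h => by omega)) .varSame
    (.varNe (by simp [h₂₃]))) plain_var
  have s₃ := s₂.subst (A := .var γ (N + 2)) (n := n₃) (hΦ (.varNe (fun h => by omega))
    (.varNe (fun h => by omega)) .varSame) plain_var
  have s₄ := s₃.subst (hΦ .varSame (.varNe (fun h => by omega))
    (.varNe (fun h => by omega))) hA
  have s₅ := s₄.subst (hΦ (.of_not_occurs hA (ha _ (by omega) _)) .varSame
    (.varNe (fun h => by omega))) hB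
  exact s₅.subst (hΦ (.of_not_occurs hA (ha _ (by omega) _))
    (.of_not_occurs hB (hb _ (by omega) _)) .varSame) hC

theorem leibniz {A B : Expr α} {H : Expr (α ⇒ omicron)} (hA : A.Plain T.consts)
    (hB : B.Plain T.consts) (hH : H.Plain T.consts) :
    Thm k T (A ≐ B ⊃ₒ H ⬝ A ≐ H ⬝ B) :=
  inst₃ (Φ := fun A B H => (A ≐ B ⊃ₒ H ⬝ A ≐ H ⬝ B))
    (fun a b h => .imp (.eqn a b) (.eqn (.app h a) (.app h b)))
    (ofAxiom (.leibniz α) (by simp)) hA hB hH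

theorem impEqn {A B : Formula} (hA : A.Plain T.consts) (hB : B.Plain T.consts)
    (hy : ¬Occurs omicron ny A) : Thm k T ((A ⊃ₒ B) ≐ (A ≐ (A ⋏ B))) := by
  have h₁ : Thm k T (impC ⬝ A ≐ .lam omicron ny (A ≐ (A ⋏ .var omicron ny))) :=
    beta (.lam (by simp) (.inl hy) (.eqn .varSame (.conj .varSame .varNe))) hA (by simp)
  exact (congr h₁ (refl hB)).trans (beta (.eqn (.of_not_occurs hA hy)
    (.conj (.of_not_occurs hA hy) .varSame)) hB (by simp [hA]))

theorem ttImp {B : Formula} (hB : B.Plain T.consts) : Thm k T ((tt ⊃ₒ B) ≐ B) :=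
  (impEqn plain_tt hB (by simp)).trans ((ttEqnEqn (by simp [hB])).trans (ttConj hB))

theorem mp {A B : Formula} (h : Thm k T (A ⊃ₒ B)) (hA : Thm k T A) : Thm k T B := by
  have hB := (plain_imp.1 h.plain).2
  exact ((congrImp hA.eqnTt (refl hB)).symm.trans (ttImp hB)).eqMp h

/-- Instantiation as an implication, usable under hypotheses. A universal statement is `λ x. T = λ
x. B`; Leibniz' law for `λ f. f A` turns it into `T = B'`. -/
theorem allImp {n : ℕ} {A : Expr α} {B B' : Formula} (h : Subst n A B B')
    (hA : A.Plain T.consts) (hB : B.Plain T.consts) : Thm k T (all α n B ⊃ₒ B') := by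
  obtain ⟨N, hN⟩ := A.exists_not_occurs
  have e : ∀ {F : Expr (α ⇒ omicron)}, F.Plain T.consts →
      Thm k T (Expr.lam (α ⇒ omicron) N (.var (α ⇒ omicron) N ⬝ A) ⬝ F ≐ F ⬝ A) := fun hF =>
    beta (.app .varSame (.of_not_occurs hA (hN N le_rfl _))) hF (by simp [hA])
  have hl : (Expr.lam α n B).Plain T.consts := hB
  have ht : (Expr.lam α n tt).Plain T.consts := by simp
  have l := leibniz (k := k) (H := .lam (α ⇒ omicron) N (.var (α ⇒ omicron) N ⬝ A)) ht hl
    (by simp [hA])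
  exact (congrImp (refl (plain_eqn.2 ⟨ht, hl⟩)) ((congrEqn ((e ht).trans (beta .tt hA plain_tt))
    ((e hl).trans (beta h hA hB))).trans (ttEqnEqn (h.plain hA hB)))).eqMp l

/-- `ff` is literally `∀ x. x`, so this is an instantiation. -/
theorem ffImp {A : Formula} (hA : A.Plain T.consts) : Thm k T (ff ⊃ₒ A) :=
  allImp (B := .var omicron nx) .varSame hA trivial

theorem ffConj {A : Formula} (hA : A.Plain T.consts) : Thm k T ((ff ⋏ A) ≐ ff) :=
  ((impEqn plain_ff hA (by simp)).eqMp (ffImp hA)).symm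

theorem conjIntro {A B : Formula} (hA : Thm k T A) (hB : Thm k T B) : Thm k T (A ⋏ B) :=
  (congrConj hA.eqnTt hB.eqnTt).eqMp (ttConjTt.symm.eqMp truth)

/-- To prove a formula, prove the cases that a part of it of type `omicron` is true or false. -/
theorem cases {n : ℕ} {A B B₁ B₂ B' : Formula} (hA : A.Plain T.consts) (hB : B.Plain T.consts)
    (h₁ : Subst n tt B B₁) (h₂ : Subst n ff B B₂) (h : Subst n A B B')
    (t₁ : Thm k T B₁) (t₂ : Thm k T B₂) : Thm k T B' := by
  have c : Thm k T (_ ⊃ₒ .var (omicron ⇒ omicron) ng ⬝ .var omicron ny) :=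
    allImp (n := nx) (B := .var (omicron ⇒ omicron) ng ⬝ .var omicron nx)
      (.app .varNe .varSame) trivial (by simp)
  have c' := (congrImp (ofAxiom .truthValues (by simp)).symm (refl (by simp))).eqMp c
  have hl : (Expr.lam omicron n B).Plain T.consts := hB
  have c'' : Thm k T _ := inst₃ (n₃ := nz) (γ := omicron)
    (Φ := fun G Y _ => (G ⬝ tt ⋏ G ⬝ ff ⊃ₒ G ⬝ Y))
    (fun a b _ => .imp (.conj (.app a .tt) (.app a .ff)) (.app a b)) c' hl hA plain_tt
  exact (beta h hA hB).eqMp (c''.mp (conjIntro ((beta h₁ plain_tt hB).symm.eqMp t₁)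
    ((beta h₂ plain_ff hB).symm.eqMp t₂)))

end Thm

/-! ## Propositional logic -/

/-- Propositional formulas with atoms `atom 0, atom 1, …`. -/
inductive PropForm : Type
  | atom (i : ℕ) : PropForm
  | fls : PropForm
  | conj (φ ψ : PropForm) : PropForm
  | disj (φ ψ : PropForm) : PropForm
  | imp (φ ψ : PropForm) : PropForm
  | neg (φ : PropForm) : PropForm
  | iff (φ ψ : PropForm) : PropForm

namespace PropForm

def eval (v : ℕ → Bool) : PropForm → Bool
  | atom i => v i
  | fls => false
  | conj φ ψ => φ.eval v && ψ.eval v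
  | disj φ ψ => φ.eval v || ψ.eval v
  | imp φ ψ => !φ.eval v || ψ.eval v
  | neg φ => !φ.eval v
  | iff φ ψ => φ.eval v == ψ.eval v

/-- The formula obtained by inserting the members of a list for the atoms. -/
def formula (l : List Formula) : PropForm → Formula
  | atom i => l.getD i tt
  | fls => ff
  | conj φ ψ => φ.formula l ⋏ ψ.formula l
  | disj φ ψ => φ.formula l ⋎ ψ.formula l
  | imp φ ψ => φ.formula l ⊃ₒ ψ.formula l
  | neg φ => CTTqe.neg (φ.formula l)
  | iff φ ψ => φ.formula l ≐ ψ.formula l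

theorem plain_formula {l : List Formula} (hl : ∀ i, (l.getD i tt).Plain T.consts)
    (φ : PropForm) : (φ.formula l).Plain T.consts := by
  induction φ <;> simp_all [formula]

theorem subst_formula {n : ℕ} {A : Expr α} {l l' : List Formula}
    (h : ∀ i, Subst n A (l.getD i tt) (l'.getD i tt)) (φ : PropForm) :
    Subst n A (φ.formula l) (φ.formula l') := by
  induction φ with
  | atom i => exact h i
  | fls => exact .ff
  | conj φ ψ ih₁ ih₂ => exact .conj ih₁ ih₂
  | disj φ ψ ih₁ ih₂ => exact .disj ih₁ ih₂
  | imp φ ψ ih₁ ih₂ => exact .imp ih₁ ih₂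
  | neg φ ih => exact .neg ih
  | iff φ ψ ih₁ ih₂ => exact .eqn ih₁ ih₂

end PropForm

/-- The formula denoting a truth value. -/
def ofBool : Bool → Formula
  | true => tt
  | false => ff

@[simp] theorem plain_ofBool (b : Bool) : (ofBool b).Plain T.consts := by
  cases b <;> simp [ofBool]

@[simp] theorem occurs_ofBool {n : ℕ} (b : Bool) : ¬Occurs α n (ofBool b) := by
  cases b <;> simp [ofBool]

theorem Subst.ofBool {n : ℕ} {A : Expr α} (b : Bool) :
    Subst n A (CTTqe.ofBool b) (CTTqe.ofBool b) := by
  cases b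
  · exact .ff
  · exact .tt

/-! ### Truth tables and tautologies -/

namespace Thm

theorem conjBool (a b : Bool) : Thm k T ((ofBool a ⋏ ofBool b) ≐ ofBool (a && b)) := by
  cases a
  · exact ffConj (plain_ofBool b)
  · exact ttConj (plain_ofBool b)

/-- Symmetry is so far only a rule for theorems and does not give this from `ttEqnFf`. Leibniz' law
for `λ x. (x = F)` gives `(F = T) ⊃ F`, hence `F = T` equals its conjunction with F, which is F. -/
theorem ffEqnTt : Thm k T ((ff ≐ tt) ≐ ff) := by
  have l := leibniz (k := k) (T := T) (H := .lam omicron 0 (.var omicron 0 ≐ ff)) plain_ff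
    plain_tt (by simp)
  have b : ∀ a, Thm k T (Expr.lam omicron 0 (.var omicron 0 ≐ ff) ⬝ ofBool a ≐ (ofBool a ≐ ff)) :=
    fun a => beta (.eqn .varSame .ff) (plain_ofBool a) (by simp)
  have h : Thm k T ((ff ≐ tt) ⊃ₒ ff) := (congrImp (refl (by simp)) ((congrEqn
    ((b false).trans (ttEqnRefl plain_ff).symm) ((b true).trans ttEqnFf)).trans ttEqnFf)).eqMp l
  have c : Thm k T (((ff ≐ tt) ⋏ ff) ≐ ff) :=
    cases (A := ff ≐ tt) (B := (.var omicron 0 ⋏ ff) ≐ ff) (n := 0) (by simp) (by simp)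
      (.eqn (.conj .varSame .ff) .ff) (.eqn (.conj .varSame .ff) .ff)
      (.eqn (.conj .varSame .ff) .ff) (ttConj plain_ff) (ffConj plain_ff)
  exact ((impEqn (by simp) plain_ff (by simp)).eqMp h).trans c

theorem eqnBool (a b : Bool) : Thm k T ((ofBool a ≐ ofBool b) ≐ ofBool (a == b)) := by
  cases a <;> cases b
  · exact (ttEqnRefl plain_ff).symm
  · exact ffEqnTt
  · exact ttEqnFf
  · exact (ttEqnRefl plain_tt).symm

theorem negBool (a : Bool) : Thm k T (neg (ofBool a) ≐ ofBool (!a)) := by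
  cases a
  · exact eqnBool false false
  · exact eqnBool false true

theorem impBool (a b : Bool) : Thm k T ((ofBool a ⊃ₒ ofBool b) ≐ ofBool (!a || b)) := by
  cases a
  · exact (ffImp (plain_ofBool b)).eqnTt.symm
  · exact ttImp (plain_ofBool b)

theorem disjBool (a b : Bool) : Thm k T ((ofBool a ⋎ ofBool b) ≐ ofBool (a || b)) := by
  have h₁ : Thm k T (orC ⬝ ofBool a ≐
      .lam omicron ny (neg (neg (ofBool a) ⋏ neg (.var omicron ny)))) :=
    beta (.lam (by simp) (.inl (by simp)) (.neg (.conj (.neg .varSame) (.neg .varNe)))) (by simp)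
      (by simp)
  have h₂ := (congr h₁ (refl (plain_ofBool b))).trans (beta
    (.neg (.conj (.neg (.ofBool a)) (.neg .varSame))) (plain_ofBool b) (by simp))
  have h₃ := h₂.trans (congrNeg (congrConj (negBool a) (negBool b)))
  have h₄ := h₃.trans ((congrNeg (conjBool _ _)).trans (negBool _))
  rwa [show (!(!a && !b)) = (a || b) by cases a <;> cases b <;> rfl] at h₄

theorem formulaBool {l : List Formula} {v : ℕ → Bool} (h : ∀ i, l.getD i tt = ofBool (v i))
    (φ : PropForm) : Thm k T (φ.formula l ≐ ofBool (φ.eval v)) := by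
  induction φ with
  | atom i =>
    rw [PropForm.formula, h]
    exact refl (plain_ofBool (v i))
  | fls => exact refl plain_ff
  | conj φ ψ ih₁ ih₂ => exact (congrConj ih₁ ih₂).trans (conjBool _ _)
  | disj φ ψ ih₁ ih₂ => exact (congrDisj ih₁ ih₂).trans (disjBool _ _)
  | imp φ ψ ih₁ ih₂ => exact (congrImp ih₁ ih₂).trans (impBool _ _)
  | neg φ ih => exact (congrNeg ih).trans (negBool _)
  | iff φ ψ ih₁ ih₂ => exact (congrEqn ih₁ ih₂).trans (eqnBool _ _)

theorem exists_not_occurs_list (l : List Formula) :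
    ∃ N, ∀ i m, N ≤ m → ∀ α, ¬Occurs α m (l.getD i tt) := by
  induction l with
  | nil => exact ⟨0, by simp⟩
  | cons A l ih =>
    obtain ⟨N, hN⟩ := ih
    obtain ⟨M, hM⟩ := A.exists_not_occurs
    refine ⟨max N M, fun i m hm α => ?_⟩
    cases i with
    | zero => exact hM m (by omega) α
    | succ i => exact hN i m (by omega) α

theorem plain_getD {l : List Formula} (hl : ∀ A ∈ l, A.Plain T.consts) (i : ℕ) :
    (l.getD i tt).Plain T.consts := by
  rw [List.getD_eq_getElem?_getD]
  rcases h : l[i]? with _ | A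
  · exact plain_tt
  · exact hl A (List.mem_of_getElem? h)

/-- Every substitution instance of a tautology is a theorem. -/
theorem taut (φ : PropForm) (l : List Formula) (h : ∀ v, φ.eval v = true)
    (hl : ∀ A ∈ l, A.Plain T.consts) : Thm k T (φ.formula l) := by
  -- The atoms are split into truth values one at a time; `p` records the values already chosen, `l`
  -- the formulas still to be treated.
  suffices H : ∀ (l : List Formula) (p : List Bool), (∀ A ∈ l, A.Plain T.consts) →
      Thm k T (φ.formula (p.map ofBool ++ l)) from H l [] hl
  intro l
  induction l with
  | nil =>
    intro p _
    have e := formulaBool (k := k) (T := T) (l := p.map ofBool ++ [])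
      -- The default `true` matches the default `tt` for atoms beyond the end of the list.
      (v := fun i => p.getD i true) (fun i => by
        simp only [List.append_nil, List.getD_eq_getElem?_getD, List.getElem?_map]
        rcases p[i]? with _ | b <;> rfl) φ
    rw [h] at e
    exact e.symm.eqMp truth
  | cons A l ih =>
    intro p hl
    have hA := hl A (by simp)
    have hl' : ∀ B ∈ l, B.Plain T.consts := fun B hB => hl B (by simp [hB])
    -- A fresh variable marks the position of the current atom, so that the case distinction leaves
    -- the later formulas untouched.
    obtain ⟨N, hN⟩ := exists_not_occurs_list l
    have hs : ∀ B : Formula, ∀ i, Subst N B ((p.map ofBool ++ .var omicron N :: l).getD i tt)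
        ((p.map ofBool ++ B :: l).getD i tt) := by
      intro B
      have h₀ : ∀ i, Subst N B ((Expr.var omicron N :: l).getD i tt) ((B :: l).getD i tt) := by
        intro i
        cases i with
        | zero => exact .varSame
        | succ i => exact .of_not_occurs (plain_getD (T := T) hl' i) (hN i N le_rfl _)
      clear ih
      induction p with
      | nil => exact h₀
      | cons b p ihp =>
        intro i
        cases i with
        | zero => exact .ofBool b
        | succ i => exact ihp i
    have t₁ := ih (p ++ [true]) hl'
    have t₂ := ih (p ++ [false]) hl'
    simp only [List.map_append, List.append_assoc] at t₁ t₂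
    refine cases hA (PropForm.plain_formula (plain_getD ?_) φ) (φ.subst_formula (hs tt))
      (φ.subst_formula (hs ff)) (φ.subst_formula (hs A)) t₁ t₂
    intro B hB
    simp only [List.mem_append, List.mem_map, List.mem_cons] at hB
    rcases hB with ⟨b, -, rfl⟩ | rfl | hB
    · exact plain_ofBool b
    · exact plain_var
    · exact hl' B hB

end Thm

/-! ## Natural deduction -/

/-- The conjunction of a list of formulas. -/
def conjList : List Formula → Formula
  | [] => tt
  | A :: Γ => A ⋏ conjList Γ

/-- `A` is derivable from the hypotheses `Γ`, whose free variables are held fixed. -/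
def Entails (k : EffectForm) (T : Theory) (Γ : List Formula) (A : Formula) : Prop :=
  Thm k T (conjList Γ ⊃ₒ A)

@[simp] theorem plain_conjList_nil : (conjList []).Plain T.consts := plain_tt

@[simp] theorem plain_conjList_cons {A : Formula} {Γ : List Formula} :
    (conjList (A :: Γ)).Plain T.consts ↔ A.Plain T.consts ∧ (conjList Γ).Plain T.consts :=
  plain_conj

@[simp] theorem occurs_conjList_nil {n : ℕ} : ¬Occurs α n (conjList []) := occurs_tt

@[simp] theorem occurs_conjList_cons {n : ℕ} {A : Formula} {Γ : List Formula} :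
    Occurs α n (conjList (A :: Γ)) ↔ Occurs α n A ∨ Occurs α n (conjList Γ) :=
  occurs_conj

namespace Entails

open PropForm (atom)

variable {Γ Δ : List Formula} {A B C E : Formula} {n : ℕ}

theorem plain_ctx (h : Entails k T Γ A) : (conjList Γ).Plain T.consts := (plain_imp.1 h.plain).1

theorem plain (h : Entails k T Γ A) : A.Plain T.consts := (plain_imp.1 (Thm.plain h)).2

theorem ofThm (h : Thm k T A) (hΓ : (conjList Γ).Plain T.consts) : Entails k T Γ A :=
  (Thm.taut (.imp (atom 0) (.imp (atom 1) (atom 0))) [A, conjList Γ]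
    (by intro v; simp only [PropForm.eval]; cases v 0 <;> cases v 1 <;> rfl)
    (by simp [h.plain, hΓ])).mp h

theorem toThm (h : Entails k T [] A) : Thm k T A := Thm.mp h .truth

theorem mp (h : Entails k T Γ (A ⊃ₒ B)) (hA : Entails k T Γ A) : Entails k T Γ B :=
  ((Thm.taut (.imp (.imp (atom 0) (.imp (atom 1) (atom 2)))
      (.imp (.imp (atom 0) (atom 1)) (.imp (atom 0) (atom 2)))) [conjList Γ, A, B]
    (by intro v; simp only [PropForm.eval]; cases v 0 <;> cases v 1 <;> cases v 2 <;> rfl)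
    (by simp [h.plain_ctx, hA.plain, (plain_imp.1 h.plain).2])).mp h).mp hA

theorem taut (hΓ : (conjList Γ).Plain T.consts) (φ : PropForm) (l : List Formula)
    (h : ∀ v, φ.eval v = true) (hl : ∀ A ∈ l, A.Plain T.consts) :
    Entails k T Γ (φ.formula l) := ofThm (Thm.taut φ l h hl) hΓ

theorem impIntro (h : Entails k T (A :: Γ) B) : Entails k T Γ (A ⊃ₒ B) :=
  Thm.mp (Thm.taut (.imp (.imp (.conj (atom 1) (atom 0)) (atom 2))
      (.imp (atom 0) (.imp (atom 1) (atom 2)))) [conjList Γ, A, B]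
    (by intro v; simp only [PropForm.eval]; cases v 0 <;> cases v 1 <;> cases v 2 <;> rfl)
    (by simpa [h.plain, and_comm] using h.plain_ctx)) h

theorem head (hA : A.Plain T.consts) (hΓ : (conjList Γ).Plain T.consts) :
    Entails k T (A :: Γ) A :=
  Thm.taut (.imp (.conj (atom 0) (atom 1)) (atom 0)) [A, conjList Γ]
    (by intro v; simp only [PropForm.eval]; cases v 0 <;> cases v 1 <;> rfl) (by simp [hA, hΓ])

theorem cons (h : Entails k T Γ A) (hB : B.Plain T.consts) : Entails k T (B :: Γ) A :=
  Thm.mp (Thm.taut (.imp (.imp (atom 0) (atom 2)) (.imp (.conj (atom 1) (atom 0)) (atom 2)))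
    [conjList Γ, B, A]
    (by intro v; simp only [PropForm.eval]; cases v 0 <;> cases v 1 <;> cases v 2 <;> rfl)
    (by simp [h.plain, h.plain_ctx, hB])) h

theorem conjLeft (h : Entails k T Γ (A ⋏ B)) : Entails k T Γ A :=
  (taut h.plain_ctx (.imp (.conj (atom 0) (atom 1)) (atom 0)) [A, B]
    (by intro v; simp only [PropForm.eval]; cases v 0 <;> cases v 1 <;> rfl)
    (by simpa using h.plain)).mp h

theorem conjRight (h : Entails k T Γ (A ⋏ B)) : Entails k T Γ B :=
  (taut h.plain_ctx (.imp (.conj (atom 0) (atom 1)) (atom 1)) [A, B]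
    (by intro v; simp only [PropForm.eval]; cases v 0 <;> cases v 1 <;> rfl)
    (by simpa using h.plain)).mp h

theorem conjIntro (hA : Entails k T Γ A) (hB : Entails k T Γ B) : Entails k T Γ (A ⋏ B) :=
  ((taut hA.plain_ctx (.imp (atom 0) (.imp (atom 1) (.conj (atom 0) (atom 1)))) [A, B]
    (by intro v; simp only [PropForm.eval]; cases v 0 <;> cases v 1 <;> rfl)
    (by simp [hA.plain, hB.plain])).mp hA).mp hB

theorem absurd (hA : Entails k T Γ A) (hn : Entails k T Γ (neg A)) (hB : B.Plain T.consts) :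
    Entails k T Γ B :=
  ((taut hA.plain_ctx (.imp (atom 0) (.imp (.neg (atom 0)) (atom 1))) [A, B]
    (by intro v; simp only [PropForm.eval]; cases v 0 <;> cases v 1 <;> rfl)
    (by simp [hA.plain, hB])).mp hA).mp hn

theorem eqMp (h : Entails k T Γ (A ≐ B)) (hA : Entails k T Γ A) : Entails k T Γ B :=
  ((taut h.plain_ctx (.imp (.iff (atom 0) (atom 1)) (.imp (atom 0) (atom 1))) [A, B]
    (by intro v; simp only [PropForm.eval]; cases v 0 <;> cases v 1 <;> rfl)
    (by simpa using h.plain)).mp h).mp hA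

/-- What is needed is `∀ x (H ⊃ A) ⊃ (H ⊃ ∀ x A)` for H without free x. It is proved by replacing H
by each truth value. -/
theorem allIntro (h : Entails k T Γ A) (hn : ¬Occurs α n (conjList Γ)) :
    Entails k T Γ (all α n A) := by
  have hA := h.plain
  have hΓ := h.plain_ctx
  obtain ⟨N, hN⟩ := A.exists_not_occurs
  obtain ⟨z, rfl⟩ : ∃ z, z = N + n + 1 := ⟨_, rfl⟩
  have hs : ∀ X : Formula, ¬Occurs α n X → Subst (N + n + 1) X
      (all α n (.var omicron (N + n + 1) ⊃ₒ A) ⊃ₒ (.var omicron (N + n + 1) ⊃ₒ all α n A))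
      (all α n (X ⊃ₒ A) ⊃ₒ (X ⊃ₒ all α n A)) := fun X hX => by
    have hz : ¬(omicron = α ∧ N + n + 1 = n) := fun h => by omega
    have sA : Subst (N + n + 1) X A A := .of_not_occurs hA (hN _ (by omega) _)
    exact .imp (.all hz hX (.imp .varSame sA)) (.imp .varSame (.all hz hX sA))
  have t₁ : Thm k T (all α n (tt ⊃ₒ A) ⊃ₒ (tt ⊃ₒ all α n A)) :=
    (Thm.taut (.imp (.iff (atom 0) (atom 1)) (.imp (atom 0) (atom 1)))
      [all α n (tt ⊃ₒ A), tt ⊃ₒ all α n A]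
      (by intro v; simp only [PropForm.eval]; cases v 0 <;> cases v 1 <;> rfl) (by simp [hA])).mp
      ((Thm.congrAll α n (Thm.ttImp hA)).trans (Thm.ttImp (plain_all.2 hA)).symm)
  have t₂ : Thm k T (all α n (ff ⊃ₒ A) ⊃ₒ (ff ⊃ₒ all α n A)) :=
    Thm.taut (.imp (atom 0) (.imp .fls (atom 1))) [all α n (ff ⊃ₒ A), all α n A]
      (by intro v; simp only [PropForm.eval]; cases v 0 <;> cases v 1 <;> rfl) (by simp [hA])
  exact (Thm.cases hΓ (by simp [hA]) (hs tt (by simp)) (hs ff (by simp)) (hs _ hn) t₁ t₂).mp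
    (Thm.allIntro α n h)

theorem allElim {X : Expr α} (h : Entails k T Γ (all α n A)) (hs : Subst n X A B)
    (hX : X.Plain T.consts) : Entails k T Γ B :=
  (ofThm (Thm.allImp hs hX (plain_all.1 h.plain)) h.plain_ctx).mp h

theorem exIntro {X : Expr α} (h : Entails k T Γ B) (hs : Subst n X A B)
    (hX : X.Plain T.consts) (hA : A.Plain T.consts) : Entails k T Γ (ex α n A) :=
  ((taut h.plain_ctx (.imp (.imp (atom 0) (.neg (atom 1))) (.imp (atom 1) (.neg (atom 0))))
    [all α n (neg A), B]
    (by intro v; simp only [PropForm.eval]; cases v 0 <;> cases v 1 <;> rfl)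
    (by simp [hA, h.plain])).mp
    (ofThm (Thm.allImp (.neg hs) hX (plain_neg.2 hA)) h.plain_ctx)).mp h

/-- By contraposition: assuming `¬C` one gets `¬A`, generalizes, and contradicts the existential
statement, which is `¬∀¬`. -/
theorem exElim (h : Entails k T Γ (ex α n A)) (hC : Entails k T (A :: Γ) C)
    (hn : ¬Occurs α n (conjList Γ)) (hnC : ¬Occurs α n C) : Entails k T Γ C := by
  have hA : A.Plain T.consts := plain_ex.1 h.plain
  have h₁ : Entails k T (neg C :: Γ) (neg A) :=
    ((taut (by simp [hC.plain, h.plain_ctx])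
      (.imp (.imp (atom 0) (atom 1)) (.imp (.neg (atom 1)) (.neg (atom 0)))) [A, C]
      (by intro v; simp only [PropForm.eval]; cases v 0 <;> cases v 1 <;> rfl)
      (by simp [hA, hC.plain])).mp (hC.impIntro.cons (plain_neg.2 hC.plain))).mp
      (head (plain_neg.2 hC.plain) h.plain_ctx)
  have h₂ := (h₁.allIntro (α := α) (n := n) (by simp [hnC, hn])).impIntro
  exact ((taut h.plain_ctx (.imp (.imp (.neg (atom 0)) (atom 1)) (.imp (.neg (atom 1)) (atom 0)))
    [C, all α n (neg A)]
    (by intro v; simp only [PropForm.eval]; cases v 0 <;> cases v 1 <;> rfl)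
    (by simp [hA, hC.plain])).mp h₂).mp h

/-! ### Equality under hypotheses -/

section Equality

variable {X Y Z : Expr α}

/-- The replacement rule accepts only derived equations. An equation that holds under hypotheses
must act through Leibniz' law, here for `λ x. E`. -/
theorem rewrite (h : Entails k T Γ (X ≐ Y)) (hA : Entails k T Γ A) (hs : Subst n X E A)
    (hs' : Subst n Y E B) (hE : E.Plain T.consts) : Entails k T Γ B := by
  have hX := (plain_eqn.1 h.plain).1
  have hY := (plain_eqn.1 h.plain).2
  have l := Thm.leibniz (k := k) (H := .lam α n E) hX hY hE
  have e := (Thm.congrImp (.refl (by simp [hX, hY])) (Thm.congrEqn (.beta hs hX hE)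
    (.beta hs' hY hE))).eqMp l
  exact ((ofThm e h.plain_ctx).mp h).eqMp hA

theorem congrArg {F : Expr (α ⇒ β)} (h : Entails k T Γ (X ≐ Y)) (hF : F.Plain T.consts) :
    Entails k T Γ (F ⬝ X ≐ F ⬝ Y) := by
  have hX := (plain_eqn.1 h.plain).1
  obtain ⟨N, hN⟩ := (F ⬝ X).exists_not_occurs
  have hFX : (F ⬝ X).Plain T.consts := ⟨hF, hX⟩
  have hN' : ¬Occurs α N (F ⬝ X) := hN N le_rfl α
  have s : ∀ Z : Expr α, Subst N Z (F ⬝ X ≐ F ⬝ .var α N) (F ⬝ X ≐ F ⬝ Z) := fun Z =>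
    .eqn (.of_not_occurs hFX hN') (.app (.of_not_occurs hF (fun ho => hN' (.inl ho))) .varSame)
  exact h.rewrite (ofThm (.refl hFX) h.plain_ctx) (s X) (s Y) (by simp [hF, hX])

theorem symm (h : Entails k T Γ (X ≐ Y)) : Entails k T Γ (Y ≐ X) := by
  have hX := (plain_eqn.1 h.plain).1
  obtain ⟨N, hN⟩ := X.exists_not_occurs
  have s : ∀ Z : Expr α, Subst N Z (.var α N ≐ X) (Z ≐ X) := fun Z =>
    .eqn .varSame (.of_not_occurs hX (hN N le_rfl α))
  exact h.rewrite (ofThm (.refl hX) h.plain_ctx) (s X) (s Y) (by simp [hX])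

theorem trans (h : Entails k T Γ (X ≐ Y)) (h' : Entails k T Γ (Y ≐ Z)) :
    Entails k T Γ (X ≐ Z) :=
  (h'.congrArg (F := .con (.eq α) ⬝ X) (by simp [(plain_eqn.1 h.plain).1])).eqMp h

/-- Applying a function to `X` is itself the function `λ f. f X`, so this reduces to `congrArg`. -/
theorem congrFun {F G : Expr (α ⇒ β)} (h : Entails k T Γ (F ≐ G)) (hX : X.Plain T.consts) :
    Entails k T Γ (F ⬝ X ≐ G ⬝ X) := by
  obtain ⟨N, hN⟩ := X.exists_not_occurs
  have b : ∀ {K : Expr (α ⇒ β)}, K.Plain T.consts →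
      Entails k T Γ (Expr.lam (α ⇒ β) N (.var (α ⇒ β) N ⬝ X) ⬝ K ≐ K ⬝ X) := fun hK =>
    ofThm (Thm.beta (.app .varSame (.of_not_occurs hX (hN N le_rfl _))) hK (by simp [hX]))
      h.plain_ctx
  exact (b (plain_eqn.1 h.plain).1).symm.trans
    ((h.congrArg (by simp [hX])).trans (b (plain_eqn.1 h.plain).2))

theorem congr {F G : Expr (α ⇒ β)} (h : Entails k T Γ (F ≐ G)) (h' : Entails k T Γ (X ≐ Y)) :
    Entails k T Γ (F ⬝ X ≐ G ⬝ Y) :=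
  (h.congrFun (plain_eqn.1 h'.plain).1).trans (h'.congrArg (plain_eqn.1 h.plain).2)

end Equality

end Entails

/-! ## The commutative ring of terms -/

section RealTerms

variable [hT : Fact (T.Extends realTheory)]

theorem Thm.ofRealAxiom {A : Formula} (h : RealAxiom A) (hA : A.Plain T.consts) : Thm k T A :=
  ⟨hA, .theoryAxiom (hT.out.2 h)⟩

variable {A B C : Expr iota}

theorem plain_con {c : Const α} (h : ¬c.IsOther := by exact id) :
    (Expr.con c).Plain T.consts :=
  hT.out.1 (show (⟨α, c⟩ : Sym) ∈ realConsts from h)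

@[simp] theorem plain_zeroI : zeroI.Plain T.consts := plain_con

@[simp] theorem plain_oneI : oneI.Plain T.consts := plain_con

@[simp] theorem plain_negI : (negI A).Plain T.consts ↔ A.Plain T.consts :=
  and_iff_right plain_con

@[simp] theorem plain_addI :
    (addI A B).Plain T.consts ↔ A.Plain T.consts ∧ B.Plain T.consts :=
  and_congr_left' (and_iff_right plain_con)

@[simp] theorem plain_mulI :
    (mulI A B).Plain T.consts ↔ A.Plain T.consts ∧ B.Plain T.consts :=
  and_congr_left' (and_iff_right plain_con)

@[simp] theorem plain_invI : (invI A).Plain T.consts ↔ A.Plain T.consts :=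
  and_iff_right plain_con

@[simp] theorem plain_twoI : twoI.Plain T.consts := by simp [twoI]

@[simp] theorem plain_posI : (posI A).Plain T.consts ↔ A.Plain T.consts :=
  and_iff_right plain_con

@[simp] theorem plain_ltI :
    (ltI A B).Plain T.consts ↔ A.Plain T.consts ∧ B.Plain T.consts :=
  and_congr_left' (and_iff_right plain_con)

@[simp] theorem plain_derivF {F : Expr (iota ⇒ iota)} :
    (derivF F).Plain T.consts ↔ F.Plain T.consts :=
  and_iff_right plain_con

@[simp] theorem plain_isDiffF {F : Expr (iota ⇒ iota)} :
    (isDiffF F).Plain T.consts ↔ F.Plain T.consts :=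
  and_iff_right plain_con

end RealTerms

/-! ### Free variables and substitution in terms of the field -/

section RealOccurs

variable {A B : Expr iota} {n : ℕ}

@[simp] theorem occurs_negI : Occurs α n (negI A) ↔ Occurs α n A := by simp [negI]

@[simp] theorem occurs_addI : Occurs α n (addI A B) ↔ Occurs α n A ∨ Occurs α n B := by
  simp [addI]

@[simp] theorem occurs_mulI : Occurs α n (mulI A B) ↔ Occurs α n A ∨ Occurs α n B := by
  simp [mulI]

@[simp] theorem occurs_twoI : ¬Occurs α n twoI := by simp [twoI]

@[simp] theorem occurs_posI : Occurs α n (posI A) ↔ Occurs α n A := by simp [posI]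

@[simp] theorem occurs_derivF {F : Expr (iota ⇒ iota)} :
    Occurs α n (derivF F) ↔ Occurs α n F := by simp [derivF]

end RealOccurs

namespace Subst

variable {n : ℕ} {X : Expr α} {A A' B B' : Expr iota}

theorem negI (h : Subst n X A A') : Subst n X (CTTqe.negI A) (CTTqe.negI A') := .app .con h

theorem invI (h : Subst n X A A') : Subst n X (CTTqe.invI A) (CTTqe.invI A') := .app .con h

theorem addI (h₁ : Subst n X A A') (h₂ : Subst n X B B') :
    Subst n X (CTTqe.addI A B) (CTTqe.addI A' B') := .app (.app .con h₁) h₂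

theorem mulI (h₁ : Subst n X A A') (h₂ : Subst n X B B') :
    Subst n X (CTTqe.mulI A B) (CTTqe.mulI A' B') := .app (.app .con h₁) h₂

theorem posI (h : Subst n X A A') : Subst n X (CTTqe.posI A) (CTTqe.posI A') := .app .con h

theorem ltI (h₁ : Subst n X A A') (h₂ : Subst n X B B') :
    Subst n X (CTTqe.ltI A B) (CTTqe.ltI A' B') := .app (.app .con h₁) h₂

end Subst

/-- Terms that are provably equal under the hypotheses `Γ`. -/
def termSetoid (k : EffectForm) (T : Theory) (Γ : List Formula) :
    Setoid {A : Expr iota // A.Plain T.consts} where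
  -- The guard makes the relation reflexive for every `Γ`, so the ring structure exists without a
  -- side condition on the context.
  r A B := (conjList Γ).Plain T.consts → Entails k T Γ (A.1 ≐ B.1)
  iseqv :=
    ⟨fun A hΓ => .ofThm (.refl A.2) hΓ, fun h hΓ => (h hΓ).symm,
      fun h h' hΓ => (h hΓ).trans (h' hΓ)⟩

/-- Terms of type `iota` modulo provable equality under the hypotheses `Γ`. -/
def TermRing (k : EffectForm) (T : Theory) (Γ : List Formula) : Type :=
  Quotient (termSetoid k T Γ)

/-- The class of a term. -/
def cls (k : EffectForm) {T : Theory} (Γ : List Formula) (A : Expr iota)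
    (hA : A.Plain T.consts) : TermRing k T Γ := Quotient.mk (termSetoid k T Γ) ⟨A, hA⟩

theorem cls_eq {Γ : List Formula} {A B : Expr iota} (h : Entails k T Γ (A ≐ B))
    (hA : A.Plain T.consts) (hB : B.Plain T.consts) : cls k Γ A hA = cls k Γ B hB :=
  Quotient.sound (s := termSetoid k T Γ) fun _ => h

theorem Entails.ofCls {Γ : List Formula} {A B : Expr iota} (hΓ : (conjList Γ).Plain T.consts)
    (hA : A.Plain T.consts) (hB : B.Plain T.consts) (h : cls k Γ A hA = cls k Γ B hB) :
    Entails k T Γ (A ≐ B) :=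
  Quotient.exact (s := termSetoid k T Γ) h hΓ

theorem cls_eq_of_thm {Γ : List Formula} {A B : Expr iota} (h : Thm k T (A ≐ B)) :
    cls k Γ A h.plain_left = cls k Γ B h.plain_right :=
  Quotient.sound (s := termSetoid k T Γ) fun hΓ => .ofThm h hΓ

section Ring

variable [Fact (T.Extends realTheory)] {Γ : List Formula}

instance : Zero (TermRing k T Γ) := ⟨cls k Γ zeroI plain_zeroI⟩

instance : One (TermRing k T Γ) := ⟨cls k Γ oneI plain_oneI⟩

instance : Neg (TermRing k T Γ) :=
  ⟨Quotient.map (fun A => ⟨negI A.1, plain_negI.2 A.2⟩) fun A B h hΓ =>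
    (h hΓ).congrArg (F := .con .neg) plain_con⟩

instance : Add (TermRing k T Γ) :=
  ⟨Quotient.map₂ (fun A B => ⟨addI A.1 B.1, plain_addI.2 ⟨A.2, B.2⟩⟩) fun A A' h B B' h' hΓ =>
    ((h hΓ).congrArg (F := .con .add) plain_con).congr (h' hΓ)⟩

instance : Mul (TermRing k T Γ) :=
  ⟨Quotient.map₂ (fun A B => ⟨mulI A.1 B.1, plain_mulI.2 ⟨A.2, B.2⟩⟩) fun A A' h B B' h' hΓ =>
    ((h hΓ).congrArg (F := .con .mul) plain_con).congr (h' hΓ)⟩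

section

variable {A B : Expr iota}

theorem cls_zero (h) : cls k (T := T) Γ zeroI h = 0 := rfl

theorem cls_one (h) : cls k (T := T) Γ oneI h = 1 := rfl

theorem cls_neg (h) :
    cls k (T := T) Γ (negI A) h = -cls k Γ A (plain_negI.1 h) := rfl

theorem cls_add (h) : cls k (T := T) Γ (addI A B) h =
    cls k Γ A (plain_addI.1 h).1 + cls k Γ B (plain_addI.1 h).2 := rfl

theorem cls_mul (h) : cls k (T := T) Γ (mulI A B) h =
    cls k Γ A (plain_mulI.1 h).1 * cls k Γ B (plain_mulI.1 h).2 := rfl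

theorem cls_two (h) : cls k (T := T) Γ twoI h = 1 + 1 := rfl

end

/-- Instances of the field axioms give the ring laws on classes. This makes `ring` and
`linear_combination` available for equalities derived inside the theory. -/
instance : CommRing (TermRing k T Γ) :=
  have add_comm : ∀ a b : TermRing k T Γ, a + b = b + a := by
    rintro ⟨A, hA⟩ ⟨B, hB⟩
    exact cls_eq_of_thm (Thm.inst₃ (γ := iota) (n₃ := nz) (Φ := fun A B _ => addI A B ≐ addI B A)
      (fun a b _ => .eqn (.addI a b) (.addI b a))
      (.ofRealAxiom .addComm (by simp)) hA hB plain_zeroI)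
  have add_zero : ∀ a : TermRing k T Γ, a + 0 = a := by
    rintro ⟨A, hA⟩
    exact cls_eq_of_thm (Thm.subst (.ofRealAxiom .addZero (by simp))
      (.eqn (.addI .varSame .con) .varSame) hA)
  have add_neg : ∀ a : TermRing k T Γ, a + -a = 0 := by
    rintro ⟨A, hA⟩
    exact cls_eq_of_thm (Thm.subst (.ofRealAxiom .addNeg (by simp))
      (.eqn (.addI .varSame (.negI .varSame)) .con) hA)
  have mul_comm : ∀ a b : TermRing k T Γ, a * b = b * a := by
    rintro ⟨A, hA⟩ ⟨B, hB⟩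
    exact cls_eq_of_thm (Thm.inst₃ (γ := iota) (n₃ := nz) (Φ := fun A B _ => mulI A B ≐ mulI B A)
      (fun a b _ => .eqn (.mulI a b) (.mulI b a))
      (.ofRealAxiom .mulComm (by simp)) hA hB plain_zeroI)
  have mul_one : ∀ a : TermRing k T Γ, a * 1 = a := by
    rintro ⟨A, hA⟩
    exact cls_eq_of_thm (Thm.subst (.ofRealAxiom .mulOne (by simp))
      (.eqn (.mulI .varSame .con) .varSame) hA)
  CommRing.ofMinimalAxioms
    (by
      rintro ⟨A, hA⟩ ⟨B, hB⟩ ⟨C, hC⟩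
      exact cls_eq_of_thm (Thm.inst₃
        (Φ := fun A B C => addI (addI A B) C ≐ addI A (addI B C))
        (fun a b c => .eqn (.addI (.addI a b) c) (.addI a (.addI b c)))
        (.ofRealAxiom .addAssoc (by simp)) hA hB hC))
    (fun a => by rw [add_comm, add_zero])
    (fun a => by rw [add_comm, add_neg])
    (by
      rintro ⟨A, hA⟩ ⟨B, hB⟩ ⟨C, hC⟩
      exact cls_eq_of_thm (Thm.inst₃
        (Φ := fun A B C => mulI (mulI A B) C ≐ mulI A (mulI B C))
        (fun a b c => .eqn (.mulI (.mulI a b) c) (.mulI a (.mulI b c)))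
        (.ofRealAxiom .mulAssoc (by simp)) hA hB hC))
    mul_comm
    (fun a => by rw [mul_comm, mul_one])
    (by
      rintro ⟨A, hA⟩ ⟨B, hB⟩ ⟨C, hC⟩
      exact cls_eq_of_thm (Thm.inst₃
        (Φ := fun A B C => mulI A (addI B C) ≐ addI (mulI A B) (mulI A C))
        (fun a b c => .eqn (.mulI a (.addI b c)) (.addI (.mulI a b) (.mulI a c)))
        (.ofRealAxiom .distrib (by simp)) hA hB hC))

end Ring

/-! ## Positive elements and inverses -/

namespace Entails

open PropForm (atom)

variable [Fact (T.Extends realTheory)] {Γ : List Formula} {A A' B B' : Expr iota}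

theorem posI_congr (h : Entails k T Γ (posI A)) (hB : B.Plain T.consts)
    (e : ∀ hA, cls k Γ A hA = cls k Γ B hB) : Entails k T Γ (posI B) :=
  ((ofCls h.plain_ctx (plain_posI.1 h.plain) hB (e _)).congrArg (F := .con .pos)
    plain_con).eqMp h

theorem posI_sub_of_ltI (h : Entails k T Γ (ltI A B)) : Entails k T Γ (posI (addI B (negI A))) :=
  (ofThm (Thm.inst₃ (γ := iota) (n₃ := nz) (Φ := fun A B _ => ltI A B ≐ posI (addI B (negI A)))
    (fun a b _ => .eqn (.ltI a b) (.posI (.addI b (.negI a))))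
    (.ofRealAxiom .ltDef (by simp)) (plain_ltI.1 h.plain).1 (plain_ltI.1 h.plain).2
    plain_zeroI) h.plain_ctx).eqMp h

theorem ltI_of_posI {C : Expr iota} (h : Entails k T Γ (posI C)) (hA : A.Plain T.consts)
    (hB : B.Plain T.consts) (e : ∀ hC, cls k Γ C hC = cls k Γ B hB - cls k Γ A hA) :
    Entails k T Γ (ltI A B) :=
  (ofThm (Thm.inst₃ (γ := iota) (n₃ := nz) (Φ := fun A B _ => ltI A B ≐ posI (addI B (negI A)))
    (fun a b _ => .eqn (.ltI a b) (.posI (.addI b (.negI a))))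
    (.ofRealAxiom .ltDef (by simp)) hA hB plain_zeroI) h.plain_ctx).symm.eqMp
    (h.posI_congr (by simp [hA, hB]) fun hC => by rw [e hC, cls_add, cls_neg, sub_eq_add_neg])

theorem posI_add (hA : Entails k T Γ (posI A)) (hB : Entails k T Γ (posI B)) :
    Entails k T Γ (posI (addI A B)) :=
  (ofThm (Thm.inst₃ (γ := iota) (n₃ := nz)
    (Φ := fun A B _ => (posI A ⋏ posI B ⊃ₒ posI (addI A B)))
    (fun a b _ => .imp (.conj (.posI a) (.posI b)) (.posI (.addI a b)))
    (.ofRealAxiom .posAdd (by simp)) (plain_posI.1 hA.plain) (plain_posI.1 hB.plain)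
    plain_zeroI) hA.plain_ctx).mp (hA.conjIntro hB)

theorem posI_mul (hA : Entails k T Γ (posI A)) (hB : Entails k T Γ (posI B)) :
    Entails k T Γ (posI (mulI A B)) :=
  (ofThm (Thm.inst₃ (γ := iota) (n₃ := nz)
    (Φ := fun A B _ => (posI A ⋏ posI B ⊃ₒ posI (mulI A B)))
    (fun a b _ => .imp (.conj (.posI a) (.posI b)) (.posI (.mulI a b)))
    (.ofRealAxiom .posMul (by simp)) (plain_posI.1 hA.plain) (plain_posI.1 hB.plain)
    plain_zeroI) hA.plain_ctx).mp (hA.conjIntro hB)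

/-- Every term is zero, positive or negative, and only one of these. -/
theorem trichotomy (hΓ : (conjList Γ).Plain T.consts) (hA : A.Plain T.consts) :
    Entails k T Γ ((A ≐ zeroI ⋏ neg (posI A) ⋏ neg (posI (negI A))) ⋎
      (A ≐̸ zeroI ⋏ posI A ⋏ neg (posI (negI A))) ⋎
      (A ≐̸ zeroI ⋏ neg (posI A) ⋏ posI (negI A))) := by
  have p : Subst nx A (posI xI) (posI A) := .posI .varSame
  have q : Subst nx A (posI (negI xI)) (posI (negI A)) := .posI (.negI .varSame)
  have e : Subst nx A (xI ≐ zeroI) (A ≐ zeroI) := .eqn .varSame .con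
  exact ofThm (Thm.subst (.ofRealAxiom .trichotomy (by simp))
    (.disj (.conj e (.conj (.neg p) (.neg q))) (.disj (.conj (.neg e) (.conj p (.neg q)))
      (.conj (.neg e) (.conj (.neg p) q)))) hA) hΓ

theorem cases_sign {C : Formula} (hA : A.Plain T.consts)
    (h₀ : Entails k T ((A ≐ zeroI) :: Γ) C) (h₁ : Entails k T (posI A :: Γ) C)
    (h₂ : Entails k T (posI (negI A) :: Γ) C) : Entails k T Γ C := by
  have hΓ := (plain_conjList_cons.1 h₁.plain_ctx).2
  have hC := h₁.plain
  refine ((((taut hΓ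
    (.imp (.disj (.conj (atom 0) (.conj (.neg (atom 1)) (.neg (atom 2))))
      (.disj (.conj (.neg (atom 0)) (.conj (atom 1) (.neg (atom 2))))
        (.conj (.neg (atom 0)) (.conj (.neg (atom 1)) (atom 2)))))
      (.imp (.imp (atom 0) (atom 3)) (.imp (.imp (atom 1) (atom 3)) (.imp (.imp (atom 2) (atom 3))
        (atom 3))))) [A ≐ zeroI, posI A, posI (negI A), C]
    (by
      intro v
      simp only [PropForm.eval]
      cases v 0 <;> cases v 1 <;> cases v 2 <;> cases v 3 <;> rfl)
    (by simp [hA, hC])).mp (trichotomy hΓ hA)).mp h₀.impIntro).mp h₁.impIntro).mp h₂.impIntro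

theorem ne_zero_and_not_neg (h : Entails k T Γ (posI A)) :
    Entails k T Γ (A ≐̸ zeroI ⋏ neg (posI (negI A))) := by
  have hA := plain_posI.1 h.plain
  exact ((taut h.plain_ctx
    (.imp (.disj (.conj (atom 0) (.conj (.neg (atom 1)) (.neg (atom 2))))
      (.disj (.conj (.neg (atom 0)) (.conj (atom 1) (.neg (atom 2))))
        (.conj (.neg (atom 0)) (.conj (.neg (atom 1)) (atom 2)))))
      (.imp (atom 1) (.conj (.neg (atom 0)) (.neg (atom 2)))))
    [A ≐ zeroI, posI A, posI (negI A)]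
    (by
      intro v
      simp only [PropForm.eval]
      cases v 0 <;> cases v 1 <;> cases v 2 <;> rfl)
    (by simp [hA])).mp (trichotomy h.plain_ctx hA)).mp h

theorem ne_zero_of_neg (h : Entails k T Γ (posI (negI A))) : Entails k T Γ (A ≐̸ zeroI) := by
  have hA : A.Plain T.consts := by simpa using h.plain
  exact ((taut h.plain_ctx
    (.imp (.disj (.conj (atom 0) (.conj (.neg (atom 1)) (.neg (atom 2))))
      (.disj (.conj (.neg (atom 0)) (.conj (atom 1) (.neg (atom 2))))
        (.conj (.neg (atom 0)) (.conj (.neg (atom 1)) (atom 2)))))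
      (.imp (atom 2) (.neg (atom 0))))
    [A ≐ zeroI, posI A, posI (negI A)]
    (by
      intro v
      simp only [PropForm.eval]
      cases v 0 <;> cases v 1 <;> cases v 2 <;> rfl)
    (by simp [hA])).mp (trichotomy h.plain_ctx hA)).mp h

/-- A term and its negative cannot both be positive. Comparing classes allows the negative to be
given in any provably equal form. -/
theorem absurd_posI {C : Formula} (h : Entails k T Γ (posI A)) (h' : Entails k T Γ (posI B))
    (hC : C.Plain T.consts) (e : ∀ hA hB, cls k (T := T) Γ B hB = -cls k Γ A hA) : Entails k T Γ C :=
  (h'.posI_congr (B := negI A) (by simpa using h.plain) fun hB => by rw [cls_neg, e]).absurd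
    h.ne_zero_and_not_neg.conjRight hC

theorem mul_invI (h : Entails k T Γ (A ≐̸ zeroI)) (hA) (hI) :
    cls k (T := T) Γ A hA * cls k Γ (invI A) hI = 1 :=
  cls_eq ((ofThm (Thm.subst (.ofRealAxiom .mulInv (by simp))
    (.imp (.neqn .varSame .con) (.eqn (.mulI .varSame (.invI .varSame)) .con)) hA)
    h.plain_ctx).mp h) (by simp [hA]) plain_oneI

/-- By trichotomy: 1 = 0 is excluded, and if −1 were positive, so would be (−1)(−1) = 1. -/
theorem posI_one (hΓ : (conjList Γ).Plain T.consts) : Entails k T Γ (posI oneI) := by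
  refine cases_sign plain_oneI ?_ (head (by simp) hΓ) ?_
  · have hΓ' : (conjList ((oneI ≐ zeroI) :: Γ)).Plain T.consts := by simp [hΓ]
    exact (head (by simp) hΓ).symm.absurd
      (ofThm (.ofRealAxiom .zeroNeOne (by simp)) hΓ') (by simp)
  · have h : Entails k T (posI (negI oneI) :: Γ) (posI (negI oneI)) := head (by simp) hΓ
    exact (h.posI_mul h).posI_congr plain_oneI fun _ => by
      simp only [cls_mul, cls_neg, cls_one]
      ring

/-- By trichotomy: a zero inverse gives 0 = 1, and a negative one makes A · (−A⁻¹) = −1 positive. -/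
theorem posI_invI (h : Entails k T Γ (posI A)) : Entails k T Γ (posI (invI A)) := by
  have hA := plain_posI.1 h.plain
  have hI : (invI A).Plain T.consts := plain_invI.2 hA
  have inv : ∀ B : Formula, B.Plain T.consts →
      cls k (B :: Γ) A hA * cls k (B :: Γ) (invI A) hI = 1 := fun B hB =>
    (h.cons hB).ne_zero_and_not_neg.conjLeft.mul_invI hA hI
  refine cases_sign hI ?_ (head (by simp [hA]) h.plain_ctx) ?_
  · have hp : (invI A ≐ zeroI).Plain T.consts := by simp [hA]
    have e := cls_eq (head (k := k) hp h.plain_ctx) hI plain_zeroI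
    have hΓ' : (conjList ((invI A ≐ zeroI) :: Γ)).Plain T.consts := by simp [h.plain_ctx, hA]
    refine absurd (ofCls hΓ' plain_zeroI plain_oneI ?_)
      (ofThm (.ofRealAxiom .zeroNeOne (by simp)) hΓ') (by simp [hA])
    have := inv _ hp
    rw [e, cls_zero, mul_zero] at this
    exact this
  · have hp : (posI (negI (invI A))).Plain T.consts := by simp [hA]
    have hn : Entails k T (posI (negI (invI A)) :: Γ) (posI (negI (invI A))) :=
      head hp h.plain_ctx
    refine (posI_one hn.plain_ctx).absurd_posI ((h.cons hp).posI_mul hn) (by simp [hA]) ?_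
    intro _ _
    simp only [cls_mul, cls_neg, cls_one]
    linear_combination -inv _ hp

end Entails

/-! ## The derivative of the square function -/

/-- The error of the approximation of the slope of `F` between `A` and `A + W` by `D`. -/
def slopeError (F : Expr (iota ⇒ iota)) (A W D : Expr iota) : Expr iota :=
  addI (mulI (addI (F ⬝ addI A W) (negI (F ⬝ A))) (invI W)) (negI D)

/-- `-U < A < U`. -/
def within (A U : Expr iota) : Formula := ltI (negI U) A ⋏ ltI A U

/-- The part of `hasDeriv F A D` that speaks about a given `U` and `V`. -/
def slopeBound (F : Expr (iota ⇒ iota)) (A D U V : Expr iota) : Formula :=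
  posI V ⋏ all iota nw (wI ≐̸ zeroI ⋏ within wI V ⊃ₒ within (slopeError F A wI D) U)

section

variable {F F' : Expr (iota ⇒ iota)} {A A' D D' U U' V V' W W' : Expr iota} {n : ℕ}

theorem Subst.slopeError {X : Expr α} (hF : Subst n X F F') (hA : Subst n X A A')
    (hW : Subst n X W W') (hD : Subst n X D D') :
    Subst n X (slopeError F A W D) (CTTqe.slopeError F' A' W' D') :=
  .addI (.mulI (.addI (.app hF (.addI hA hW)) (.negI (.app hF hA))) (.invI hW)) (.negI hD)

theorem Subst.within {X : Expr α} (hA : Subst n X A A') (hU : Subst n X U U') :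
    Subst n X (within A U) (CTTqe.within A' U') :=
  .conj (.ltI (.negI hU) hA) (.ltI hA hU)

theorem Subst.slopeBound {X : Expr α} (hn : ¬(α = iota ∧ n = nw)) (hX : ¬Occurs iota nw X)
    (hF : Subst n X F F') (hA : Subst n X A A') (hD : Subst n X D D') (hU : Subst n X U U')
    (hV : Subst n X V V') : Subst n X (slopeBound F A D U V) (CTTqe.slopeBound F' A' D' U' V') :=
  .conj (.posI hV) (.all hn hX (.imp (.conj (.neqn (.varNe hn) .con) (.within (.varNe hn) hV))
    (.within (.slopeError hF hA (.varNe hn) hD) hU)))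

theorem Subst.hasDeriv {X : Expr α} (hn : ∀ m ∈ [nu, nv, nw], ¬(α = iota ∧ n = m))
    (hX : ∀ m ∈ [nu, nv, nw], ¬Occurs iota m X) (hF : Subst n X F F') (hA : Subst n X A A')
    (hD : Subst n X D D') : Subst n X (hasDeriv F A D) (CTTqe.hasDeriv F' A' D') :=
  have hu : Subst n X uI uI := .varNe (hn nu (by simp))
  have hv : Subst n X vI vI := .varNe (hn nv (by simp))
  .all (hn nu (by simp)) (hX nu (by simp)) (.imp (.posI hu) (.ex (hn nv (by simp))
    (hX nv (by simp)) (.slopeBound (hn nw (by simp)) (hX nw (by simp)) hF hA hD hu hv)))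

variable [Fact (T.Extends realTheory)]

@[simp] theorem plain_slopeError : (slopeError F A W D).Plain T.consts ↔
    F.Plain T.consts ∧ A.Plain T.consts ∧ W.Plain T.consts ∧ D.Plain T.consts := by
  simp [slopeError]; tauto

@[simp] theorem plain_within :
    (within A U).Plain T.consts ↔ A.Plain T.consts ∧ U.Plain T.consts := by
  simp [within]; tauto

@[simp] theorem plain_slopeBound : (slopeBound F A D U V).Plain T.consts ↔
    F.Plain T.consts ∧ A.Plain T.consts ∧ D.Plain T.consts ∧ U.Plain T.consts ∧
      V.Plain T.consts := by
  simp [slopeBound]; tauto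

@[simp] theorem plain_hasDeriv : (hasDeriv F A D).Plain T.consts ↔
    F.Plain T.consts ∧ A.Plain T.consts ∧ D.Plain T.consts := by
  -- `slopeError`, `within` and `slopeBound` are cut out so that `hasDeriv` unfolds to exactly this.
  change (all iota nu (posI uI ⊃ₒ ex iota nv (slopeBound F A D uI vI))).Plain T.consts ↔ _
  simp

end

/-- The square function. -/
def sqF : Expr (iota ⇒ iota) := .lam iota nx (powI xI 2)

@[simp] theorem occurs_sqF {n : ℕ} : ¬Occurs α n sqF := by simp [sqF, powI]

variable [Fact (T.Extends realTheory)]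

@[simp] theorem plain_sqF : sqF.Plain T.consts := by simp [sqF, powI]

/-- The factor 1 appears because `powI` starts from the power 0. -/
theorem cls_sqF {Γ : List Formula} {A : Expr iota} (hA : A.Plain T.consts) (h) :
    cls k Γ (sqF ⬝ A) h = 1 * cls k Γ A hA * cls k Γ A hA :=
  cls_eq_of_thm (B := powI A 2)
    (Thm.beta (.mulI (.mulI .con .varSame) .varSame) hA (by simp))

namespace Entails

variable {Γ : List Formula} {A B D U V W X : Expr iota}

/-- (X + W)² − X² = (2X + W)W, and W cancels against its inverse. All later estimates use only this
linear form of the error. -/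
theorem cls_slopeError (h : Entails k T Γ (W ≐̸ zeroI)) (hW : W.Plain T.consts)
    (hX : X.Plain T.consts) (hD : D.Plain T.consts) (hS) :
    cls k Γ (slopeError sqF X W D) hS =
      cls k Γ W hW + (1 + 1) * cls k Γ X hX - cls k Γ D hD := by
  have i := h.mul_invI hW (plain_invI.2 hW)
  simp only [slopeError, cls_add, cls_mul, cls_neg]
  rw [cls_sqF (plain_addI.2 ⟨hX, hW⟩), cls_sqF hX]
  simp only [cls_add]
  linear_combination (2 * cls k Γ X hX + cls k Γ W hW) * i

theorem within_congr (h : Entails k T Γ (within A U)) (hB : B.Plain T.consts)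
    (e : ∀ hA, cls k Γ A hA = cls k Γ B hB) : Entails k T Γ (within B U) := by
  obtain ⟨hA, hU⟩ := plain_within.1 h.plain
  refine conjIntro (h.conjLeft.posI_sub_of_ltI.ltI_of_posI (by simp [hU]) hB fun _ => ?_)
    (h.conjRight.posI_sub_of_ltI.ltI_of_posI hB hU fun _ => ?_)
  · simp only [cls_add, cls_neg, e hA]
    ring
  · simp only [cls_add, cls_neg, e hA]
    ring

theorem hasDeriv_sqF : Entails k T [] (hasDeriv sqF xI (mulI twoI xI)) := by
  have h : Entails k T [posI uI]
      (slopeBound sqF xI (mulI twoI xI) uI uI) := by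
    refine conjIntro (head (by simp) (by simp)) (allIntro (impIntro ?_) (by simp))
    have hK : Entails k T [wI ≐̸ zeroI ⋏ within wI uI, posI uI]
      (wI ≐̸ zeroI ⋏ within wI uI) := head (by simp) (by simp)
    -- For the slope 2x the error is w itself, so the bound on w is already the required bound.
    refine hK.conjRight.within_congr (by simp) fun hw => ?_
    rw [hK.conjLeft.cls_slopeError hw (X := xI) (by simp) (by simp)]
    simp only [cls_mul, cls_two]
    ring
  -- The witness for v is u.
  refine (impIntro (exIntro (X := uI) (n := nv)
    (A := slopeBound sqF xI (mulI twoI xI) uI vI) h ?_ plain_var (by simp))).allIntro (n := nu) (by simp)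
  have s : ∀ C : Expr iota, C.Plain T.consts → ¬Occurs iota nv C → Subst nv uI C C :=
    fun C hC ho => .of_not_occurs hC ho
  exact .slopeBound (by simp) (by simp) (.of_not_occurs (plain_sqF (T := T)) occurs_sqF)
    (s _ (by simp) (by simp)) (s _ (by simp) (by simp)) (s _ (by simp) (by simp)) .varSame

theorem within_of_slopeBound (h : Entails k T Γ (slopeBound sqF X D U V))
    (hne : Entails k T Γ (W ≐̸ zeroI)) (hW : Entails k T Γ (within W V))
    (hn : ∀ C ∈ [X, D, U, V], ¬Occurs iota nw C) :
    Entails k T Γ (within (slopeError sqF X W D) U) := by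
  obtain ⟨-, hX, hD, hU, hV⟩ := plain_slopeBound.1 h.plain
  have hW' := (plain_within.1 hW.plain).1
  have s : ∀ C : Expr iota, C.Plain T.consts → C ∈ [X, D, U, V] → Subst nw W C C :=
    fun C hC hm => .of_not_occurs hC (hn C hm)
  refine (h.conjRight.allElim (X := W) (.imp (.conj (.neqn .varSame .con)
    (.within .varSame (s V hV (by simp)))) (.within (.slopeError
      (.of_not_occurs (plain_sqF (T := T)) occurs_sqF) (s X hX (by simp)) .varSame
      (s D hD (by simp))) (s U hU (by simp)))) hW').mp (hne.conjIntro hW)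

/-- `U` is placed under the binders of v and w and must avoid both; `X` and `D` must avoid the
variable u that `U` replaces. -/
theorem exists_slopeBound (h : Entails k T Γ (hasDeriv sqF X D)) (hU : Entails k T Γ (posI U))
    (hX : ¬Occurs iota nu X) (hD : ¬Occurs iota nu D)
    (hn : ∀ m ∈ [nv, nw], ¬Occurs iota m U) :
    Entails k T Γ (ex iota nv (slopeBound sqF X D U vI)) := by
  obtain ⟨-, hX', hD'⟩ := plain_hasDeriv.1 h.plain
  exact (allElim (n := nu) (A := posI uI ⊃ₒ ex iota nv (slopeBound sqF X D uI vI)) h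
    (.imp (.posI .varSame) (.ex (by simp) (hn nv (by simp)) (.slopeBound (by simp)
      (hn nw (by simp)) (.of_not_occurs (plain_sqF (T := T)) occurs_sqF) (.of_not_occurs hX' hX)
      (.of_not_occurs hD' hD) .varSame .varNe))) (plain_posI.1 hU.plain)).mp hU

/-- The square function has no derivative at `xI` other than `2 * xI`. -/
theorem hasDeriv_sqF_unique (hD : D.Plain T.consts) (hn : ∀ m ∈ [nu, nv, nw], ¬Occurs iota m D) :
    Entails k T [hasDeriv sqF xI D] (D ≐ mulI twoI xI) := by
  -- `E` is 2x − D, the quantity to be shown zero; the three signs of `E` are the three cases below.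
  obtain ⟨E, hE⟩ : ∃ E, E = addI (mulI twoI xI) (negI D) := ⟨_, rfl⟩
  have pE : E.Plain T.consts := by simp [hE, hD]
  have nE : ∀ m ∈ [nu, nv, nw], ¬Occurs iota m E := fun m hm ho => by
    have : m = nx := by simpa [hE, hn m hm] using ho
    subst this
    simp at hm
  have clsE : ∀ Γ, cls k Γ E pE = (1 + 1) * cls k Γ xI plain_var - cls k Γ D hD := fun Γ => by
    subst hE
    rw [sub_eq_add_neg]
    rfl
  have hv := hn nv (by simp)
  -- `H` is v/2. It or its negative serves as the increment w: nonzero and strictly within v.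
  obtain ⟨H, hH⟩ : ∃ H, H = mulI vI (invI twoI) := ⟨_, rfl⟩
  have pH : H.Plain T.consts := by simp [hH]
  have half : ∀ {Γ}, Entails k T Γ (posI vI) → Entails k T Γ (posI H) ∧
      cls k Γ H pH + cls k Γ H pH = cls k Γ vI plain_var := fun {Γ} h => by
    subst hH
    have h₂ : Entails k T Γ (posI twoI) := (posI_one h.plain_ctx).posI_add (posI_one h.plain_ctx)
    refine ⟨h.posI_mul h₂.posI_invI, ?_⟩
    have i := h₂.ne_zero_and_not_neg.conjLeft.mul_invI plain_twoI (plain_invI.2 plain_twoI)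
    rw [cls_two] at i
    simp only [cls_mul]
    linear_combination (cls k Γ vI plain_var) * i
  have pG : (hasDeriv sqF xI D).Plain T.consts := by simp [hD]
  have hyp : ∀ C : Formula, C.Plain T.consts →
      Entails k T [C, hasDeriv sqF xI D] (hasDeriv sqF xI D) := fun C hC =>
    (head pG plain_conjList_nil).cons hC
  have nG : ¬Occurs iota nv (hasDeriv sqF xI D) := by
    change ¬Occurs iota nv (all iota nu (posI uI ⊃ₒ ex iota nv (slopeBound sqF xI D uI vI)))
    simp
  refine cases_sign pE ?_ ?_ ?_
  · have p : (E ≐ zeroI).Plain T.consts := by simp [pE]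
    have h := cls_eq (head (k := k) p (plain_conjList_cons.2 ⟨pG, plain_conjList_nil⟩)) pE
      plain_zeroI
    refine ofCls (by simp [pE, hD]) hD (by simp) ?_
    rw [clsE, cls_zero] at h
    simp only [cls_mul, cls_two]
    linear_combination -h
  -- Case E > 0: take u = E and w = v/2. The error is w + E, and the upper bound w + E < E makes −w
  -- positive.
  · have p : (posI E).Plain T.consts := by simp [pE]
    have hp : Entails k T [posI E, hasDeriv sqF xI D] (posI E) := head p (by simp [hD])
    refine exElim ((hyp _ p).exists_slopeBound hp (by simp) (hn nu (by simp))
      fun m hm => nE m (by simp_all)) ?_ (by simp [nE nv, nG]) (by simp [hv])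
    have b : Entails k T (slopeBound sqF xI D E vI :: [posI E, hasDeriv sqF xI D])
      (slopeBound sqF xI D E vI) := head (by simp [pE, hD]) hp.plain_ctx
    obtain ⟨h, e⟩ := half b.conjLeft
    have w : Entails k T _ (within H vI) := conjIntro
      ((h.posI_add b.conjLeft).ltI_of_posI (by simp) pH fun _ => by
        simp only [cls_add, cls_neg]; ring)
      (h.ltI_of_posI pH (by simp) fun _ => by linear_combination e)
    have hne := h.ne_zero_and_not_neg.conjLeft
    have r := (b.within_of_slopeBound hne w (by simp [hn nw, nE nw])).conjRight
    refine h.absurd_posI r.posI_sub_of_ltI (by simp [hD]) fun _ _ => ?_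
    rw [cls_add, cls_neg, hne.cls_slopeError pH plain_var hD, clsE]
    ring
  -- Case E < 0: take u = −E and w = −v/2. The error is again w + E, and the lower bound E < w + E
  -- makes w = −v/2 positive.
  · have p : (posI (negI E)).Plain T.consts := by simp [pE]
    have hp : Entails k T [posI (negI E), hasDeriv sqF xI D] (posI (negI E)) :=
      head p (by simp [hD])
    refine exElim ((hyp _ p).exists_slopeBound hp (by simp) (hn nu (by simp))
      fun m hm => by simpa using nE m (by simp_all)) ?_ (by simp [nE nv, nG]) (by simp [hv])
    have b : Entails k T (slopeBound sqF xI D (negI E) vI :: [posI (negI E), hasDeriv sqF xI D])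
      (slopeBound sqF xI D (negI E) vI) := head (by simp [pE, hD]) hp.plain_ctx
    obtain ⟨h, e⟩ := half b.conjLeft
    have pN : (negI H).Plain T.consts := plain_negI.2 pH
    have w : Entails k T _ (within (negI H) vI) := conjIntro
      (h.ltI_of_posI (by simp) pN fun _ => by
        simp only [cls_neg]; linear_combination e)
      ((h.posI_add b.conjLeft).ltI_of_posI pN (by simp) fun _ => by
        simp only [cls_add, cls_neg]; ring)
    have hne : Entails k T _ (negI H ≐̸ zeroI) := (h.posI_congr (B := negI (negI H))
      (by simp [pH]) fun _ => by simp only [cls_neg]; ring).ne_zero_of_neg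
    have r := (b.within_of_slopeBound hne w (by simp [hn nw, nE nw])).conjLeft
    refine h.absurd_posI r.posI_sub_of_ltI (by simp [hD]) fun _ _ => ?_
    rw [cls_add, cls_neg, hne.cls_slopeError pN plain_var hD, cls_neg, cls_neg, cls_neg, clsE]
    ring

end Entails

/-! ### Differentiability of the square and the value of its derivative -/

theorem Thm.isDiff_sqF : Thm k T (isDiffF sqF) := by
  have d : Thm k T (isDiffF sqF ≐ all iota nx (ex iota ny (hasDeriv sqF xI yI))) :=
    Thm.substEqn (.ofRealAxiom .isDiffDef (by simp)) (.app .con .varSame)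
      (.all (by simp) (by simp) (.ex (by simp) (by simp)
        (.hasDeriv (by simp) (by simp) .varSame .varNe .varNe))) plain_sqF
  refine d.symm.eqMp (allIntro _ _ (Entails.toThm (Entails.hasDeriv_sqF.exIntro ?_
    (X := mulI twoI xI) (by simp) (by simp))))
  exact .hasDeriv (by simp) (by simp) (.of_not_occurs (plain_sqF (T := T)) occurs_sqF) .varNe
    .varSame

/-- The specification of `deriv` makes `derivF sqF ⬝ xI` a derivative at x, and uniqueness
identifies it. That this slope contains x is allowed: uniqueness excludes only u, v and w. -/
theorem Thm.derivF_sqF_apply : Thm k T (derivF sqF ⬝ xI ≐ mulI twoI xI) := by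
  have d : Thm k T (isDiffF sqF ⊃ₒ all iota nx (hasDeriv sqF xI (derivF sqF ⬝ xI))) :=
    Thm.subst (.ofRealAxiom .derivSpec (by simp)) (.imp (.app .con .varSame)
      (.all (by simp) (by simp) (.hasDeriv (by simp) (by simp) .varSame .varNe
        (.app (.app .con .varSame) .varNe)))) plain_sqF
  have h := (d.mp isDiff_sqF).allElim (A := xI) (.self (D := T.consts) (by simp)) plain_var
  exact Thm.mp (Entails.toThm (Entails.impIntro (Entails.hasDeriv_sqF_unique (by simp) (by simp))))
    h

theorem Thm.derivF_sqF : Thm k T (derivF sqF ≐ .lam iota nx (mulI twoI xI)) := by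
  have b : Thm k T (Expr.lam iota nx (mulI twoI xI) ⬝ xI ≐ mulI twoI xI) :=
    beta (.self (D := T.consts) (by simp)) plain_var (by simp)
  exact (ext (by simp) (by simp) (by simp) (by simp) (by simp)).symm.eqMp
    (allIntro _ _ (derivF_sqF_apply.trans b.symm))

end CTTqe

theorem mainTheorem12 (k : CTTqe.EffectForm) (T : CTTqe.Theory)
    (hT : T.Extends CTTqe.realTheory) :
    CTTqe.Proves k T
      (CTTqe.eqn (CTTqe.derivF (.lam .iota CTTqe.nx (CTTqe.powI CTTqe.xI 2)))
        (.lam .iota CTTqe.nx (CTTqe.mulI CTTqe.twoI CTTqe.xI))) := by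
  have : Fact (T.Extends CTTqe.realTheory) := ⟨hT⟩
  exact CTTqe.Thm.derivF_sqF.proves
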